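/- Let $L^2(\mathbb{C},e^{-|z|^2})$ be the space of measurable functions $f$ with $\int_{\mathbb{C}}|f|^2e^{-|z|^2}\,d\lambda<\infty$ ($\lambda$ = Lebesgue measure on $\mathbb C$); a $(0,1)$-form $g\,d\bar z$ on $\mathbb{C}$ is identified with its coefficient $g$, and $L^2_{(0,1)}(\mathbb{C},e^{-|z|^2})$ with $L^2(\mathbb{C},e^{-|z|^2})$. For $\varphi(z)=|z|^2$ let $\bar\partial f=\frac{\partial f}{\partial\bar z}$ and $\bar\partial_\varphi^*g=-\left(\frac{\partial g}{\partial z}-\bar z\,g\right)$, and let $\square_{\varphi,0}$ and $\square_{\varphi,1}$ be the operator closures in $L^2(\mathbb{C},e^{-|z|^2})$ of $\bar\partial_\varphi^*\bar\partial$ and $\bar\partial\,\bar\partial_\varphi^*$ on $\mathcal{C}_0^\infty(\mathbb{C})$. On $\mathcal{C}_0^\infty(\mathbb C)$ they act as $$\square_{\varphi,0}f=-f_{z\bar z}+\bar z f_{\bar z},\qquad \square_{\varphi,1}f=-f_{z\bar z}+\bar z f_{\bar z}+f,$$ and both closures are self-adjoint. For $k,m\in\mathbb{N}_0=\{0,1,2,\dots\}$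 put $$u_{k,m}=\bar z^{k+m}z^m+\sum_{j=1}^m\frac{(-1)^j(k+m)!\,m!}{j!\,(k+m-j)!\,(m-j)!}\,\bar z^{k+m-j}z^{m-j},$$ $$v_{k,m}=\bar z^{k}z^{k+m}+\sum_{j=1}^k\frac{(-1)^j(k+m)!\,k!}{j!\,(k+m-j)!\,(k-j)!}\,\bar z^{k-j}z^{k+m-j}$$ (so $u_{k,0}=\bar z^k$ and $v_{0,m}=z^m$). (a) The spectrum of $\square_{\varphi,0}$ is $\{0,1,2,\dots\}$; each of these numbers is an eigenvalue of infinite multiplicity, and $0$ is the smallest element of the essential spectrum (the spectrum without the isolated eigenvalues of finite multiplicity). (b) The spectrum of $\square_{\varphi,1}$ is $\{1,2,3,\dots\}$; each of these numbers is an eigenvalue of infinite multiplicity. (c) For all $k,m\in\mathbb{N}_0$, $u_{k,m}$ is an eigenfunction of $\square_{\varphi,0}$ for the eigenvalue $k+m$ and of $\square_{\varphi,1}$ for the eigenvalue $k+m+1$, and $v_{k,m}$ is an eigenfunction of $\square_{\varphi,0}$ for the eigenvalue $k$ and of $\square_{\varphi,1}$ for the eigenvalue $k+1$. For every $n\in\mathbb{N}_0$,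 the eigenspace of $\square_{\varphi,0}$ for $n$ and that of $\square_{\varphi,1}$ for $n+1$ are both the closed linear span of $\{u_{k,m}:k+m=n\}\cup\{v_{n,m}:m\ge 0\}$. -/

import Mathlib

open scoped ContDiff

noncomputable section

namespace DbarNeumann

open MeasureTheory Complex

/-! ### Wirtinger derivatives, `∂̄` and its formal weighted adjoint on `ℂ` -/

/-- The Wirtinger derivative `∂f/∂z = (∂f/∂x - i ∂f/∂y) / 2`. -/
def dz (f : ℂ → ℂ) (z : ℂ) : ℂ := (1 / 2) * (fderiv ℝ f z 1 - I * fderiv ℝ f z I)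

/-- The Wirtinger derivative `∂f/∂z̄ = (∂f/∂x + i ∂f/∂y) / 2`. The `(0,1)`-form `g dz̄` on `ℂ`
is represented by its coefficient `g`, so this is also the operator `∂̄` from functions to
`(0,1)`-forms. -/
def dbar (f : ℂ → ℂ) (z : ℂ) : ℂ := (1 / 2) * (fderiv ℝ f z 1 + I * fderiv ℝ f z I)

/-- The formal adjoint `∂̄*_φ (g dz̄) = -(∂g/∂z - (∂φ/∂z) g)` of `∂̄` with respect to the weight
`e^{-φ}`. -/
def dbarStar (φ : ℂ → ℝ) (g : ℂ → ℂ) (z : ℂ) : ℂ :=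
  -(dz g z - dz (fun w => (φ w : ℂ)) z * g z)

lemma contDiff_fderiv_apply {f : ℂ → ℂ} (hf : ContDiff ℝ ∞ f) (v : ℂ) :
    ContDiff ℝ ∞ (fun z => fderiv ℝ f z v) :=
  (hf.fderiv_right (m := ∞) (by simp)).clm_apply contDiff_const

lemma contDiff_dz {f : ℂ → ℂ} (hf : ContDiff ℝ ∞ f) : ContDiff ℝ ∞ (dz f) :=
  contDiff_const.mul
    ((contDiff_fderiv_apply hf 1).sub (contDiff_const.mul (contDiff_fderiv_apply hf I)))

lemma contDiff_dbar {f : ℂ → ℂ} (hf : ContDiff ℝ ∞ f) : ContDiff ℝ ∞ (dbar f) :=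
  contDiff_const.mul
    ((contDiff_fderiv_apply hf 1).add (contDiff_const.mul (contDiff_fderiv_apply hf I)))

/-- The space `C_0^∞(ℂ)` of smooth complex-valued functions with compact support. -/
def testFunctions : Submodule ℂ (ℂ → ℂ) where
  carrier := {f | ContDiff ℝ ∞ f ∧ HasCompactSupport f}
  zero_mem' := ⟨contDiff_const, HasCompactSupport.zero⟩
  add_mem' hf hg := ⟨hf.1.add hg.1, hf.2.add hg.2⟩
  smul_mem' _ _ hf := ⟨contDiff_const.smul hf.1, HasCompactSupport.smul_left hf.2⟩

lemma dz_mem {f : ℂ → ℂ} (hf : f ∈ testFunctions) : dz f ∈ testFunctions := by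
  refine ⟨contDiff_dz hf.1, ?_⟩
  refine HasCompactSupport.mono' (hf.2.fderiv (𝕜 := ℝ)) ?_
  refine Function.support_subset_iff'.2 fun z hz => ?_
  have : fderiv ℝ f z = 0 := by
    by_contra h
    exact hz (subset_tsupport _ h)
  simp [dz, this]

lemma dbar_mem {f : ℂ → ℂ} (hf : f ∈ testFunctions) : dbar f ∈ testFunctions := by
  refine ⟨contDiff_dbar hf.1, ?_⟩
  refine HasCompactSupport.mono' (hf.2.fderiv (𝕜 := ℝ)) ?_
  refine Function.support_subset_iff'.2 fun z hz => ?_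
  have : fderiv ℝ f z = 0 := by
    by_contra h
    exact hz (subset_tsupport _ h)
  simp [dbar, this]

lemma dbarStar_mem {φ : ℂ → ℝ} (hφ : ContDiff ℝ ∞ φ) {f : ℂ → ℂ} (hf : f ∈ testFunctions) :
    dbarStar φ f ∈ testFunctions := by
  have h1 : (fun z => dz (fun w => (φ w : ℂ)) z * f z) ∈ testFunctions :=
    ⟨(contDiff_dz (ofRealCLM.contDiff.comp hφ)).mul hf.1, hf.2.mul_left⟩
  exact testFunctions.neg_mem (testFunctions.sub_mem (dz_mem hf) h1)

lemma differentiable_of_mem {f : ℂ → ℂ} (hf : f ∈ testFunctions) : Differentiable ℝ f :=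
  hf.1.differentiable (by simp)

/-- `∂̄` as a linear map on test functions. -/
def dbarLin : testFunctions →ₗ[ℂ] testFunctions where
  toFun f := ⟨dbar f, dbar_mem f.2⟩
  map_add' f g := by
    ext z
    simp only [dbar, Submodule.coe_add, Pi.add_apply]
    rw [fderiv_add (differentiable_of_mem f.2 z) (differentiable_of_mem g.2 z)]
    simp only [add_apply]
    ring
  map_smul' c f := by
    ext z
    simp only [dbar, Submodule.coe_smul, Pi.smul_apply, RingHom.id_apply, smul_eq_mul]
    rw [fderiv_const_smul (differentiable_of_mem f.2 z)]
    simp only [smul_apply, smul_eq_mul]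
    ring

/-- `∂̄*_φ` as a linear map on test functions. -/
def dbarStarLin (φ : ℂ → ℝ) (hφ : ContDiff ℝ ∞ φ) : testFunctions →ₗ[ℂ] testFunctions where
  toFun f := ⟨dbarStar φ f, dbarStar_mem hφ f.2⟩
  map_add' f g := by
    ext z
    simp only [dbarStar, dz, Submodule.coe_add, Pi.add_apply]
    rw [fderiv_add (differentiable_of_mem f.2 z) (differentiable_of_mem g.2 z)]
    simp only [add_apply]
    ring
  map_smul' c f := by
    ext z
    simp only [dbarStar, dz, Submodule.coe_smul, Pi.smul_apply, RingHom.id_apply, smul_eq_mul]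
    rw [fderiv_const_smul (differentiable_of_mem f.2 z)]
    simp only [smul_apply, smul_eq_mul]
    ring

/-! ### The weighted space `L²(ℂ, e^{-φ})` and the complex Laplacians -/

/-- The measure `e^{-φ} dλ` on `ℂ`, with `λ` Lebesgue measure. -/
def weightMeasure (φ : ℂ → ℝ) : Measure ℂ :=
  volume.withDensity (fun z => ENNReal.ofReal (Real.exp (-φ z)))

/-- The Hilbert space `L²(ℂ, e^{-φ})`; through `g dz̄ ↔ g` it is also the space
`L²_{(0,1)}(ℂ, e^{-φ})` of `(0,1)`-forms. -/
abbrev L2 (φ : ℂ → ℝ) : Type := Lp ℂ 2 (weightMeasure φ)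

lemma isLocallyFiniteMeasure_weightMeasure {φ : ℂ → ℝ} (hφ : ContDiff ℝ ∞ φ) :
    IsLocallyFiniteMeasure (weightMeasure φ) :=
  IsLocallyFiniteMeasure.withDensity_ofReal (Real.continuous_exp.comp hφ.continuous.neg)

lemma isOpenPosMeasure_weightMeasure {φ : ℂ → ℝ} (hφ : ContDiff ℝ ∞ φ) :
    (weightMeasure φ).IsOpenPosMeasure := by
  have hc : Continuous fun z => ENNReal.ofReal (Real.exp (-φ z)) :=
    ENNReal.continuous_ofReal.comp (Real.continuous_exp.comp hφ.continuous.neg)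
  exact (withDensity_absolutelyContinuous' hc.aemeasurable
    (Filter.Eventually.of_forall fun z => by
      simpa using Real.exp_pos (-φ z))).isOpenPosMeasure

lemma memLp_test {φ : ℂ → ℝ} (hφ : ContDiff ℝ ∞ φ) {f : ℂ → ℂ} (hf : f ∈ testFunctions) :
    MemLp f 2 (weightMeasure φ) :=
  haveI := isLocallyFiniteMeasure_weightMeasure hφ
  hf.1.continuous.memLp_of_hasCompactSupport hf.2

/-- The inclusion of the test functions in `L²(ℂ, e^{-φ})`. -/
def testToL2 (φ : ℂ → ℝ) (hφ : ContDiff ℝ ∞ φ) : testFunctions →ₗ[ℂ] L2 φ where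
  toFun f := (memLp_test hφ f.2).toLp f
  map_add' f g := MemLp.toLp_add (memLp_test hφ f.2) (memLp_test hφ g.2)
  map_smul' c f := MemLp.toLp_const_smul c (memLp_test hφ f.2)

lemma testToL2_injective (φ : ℂ → ℝ) (hφ : ContDiff ℝ ∞ φ) :
    Function.Injective (testToL2 φ hφ) := by
  intro f g h
  have := isOpenPosMeasure_weightMeasure hφ
  have h' : (f : ℂ → ℂ) =ᵐ[weightMeasure φ] g := (MemLp.toLp_eq_toLp_iff (memLp_test hφ f.2) (memLp_test hφ g.2)).1 h
  exact Subtype.ext (Measure.eq_of_ae_eq h' f.2.1.continuous g.2.1.continuous)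

/-- The operator in `L²(ℂ, e^{-φ})` with domain `C_0^∞(ℂ)` that acts as `A`. -/
def onTest (φ : ℂ → ℝ) (hφ : ContDiff ℝ ∞ φ) (A : testFunctions →ₗ[ℂ] testFunctions) :
    L2 φ →ₗ.[ℂ] L2 φ where
  domain := LinearMap.range (testToL2 φ hφ)
  toFun := testToL2 φ hφ ∘ₗ A ∘ₗ
    (LinearEquiv.ofInjective (testToL2 φ hφ) (testToL2_injective φ hφ)).symm.toLinearMap

/-- The complex Laplacian `□_{φ,0} = ∂̄*_φ ∂̄` on functions: the operator closure in
`L²(ℂ, e^{-φ})` of its restriction to `C_0^∞(ℂ)`. -/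
def box0 (φ : ℂ → ℝ) (hφ : ContDiff ℝ ∞ φ) : L2 φ →ₗ.[ℂ] L2 φ :=
  (onTest φ hφ (dbarStarLin φ hφ ∘ₗ dbarLin)).closure

/-- The complex Laplacian `□_{φ,1} = ∂̄ ∂̄*_φ` on `(0,1)`-forms: the operator closure in
`L²_{(0,1)}(ℂ, e^{-φ})` of its restriction to the forms with coefficient in `C_0^∞(ℂ)`. -/
def box1 (φ : ℂ → ℝ) (hφ : ContDiff ℝ ∞ φ) : L2 φ →ₗ.[ℂ] L2 φ :=
  (onTest φ hφ (dbarLin ∘ₗ dbarStarLin φ hφ)).closure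

/-- The weight `φ(z) = |z|²`. -/
def sqWeight (z : ℂ) : ℝ := ‖z‖ ^ 2

lemma sqWeight_contDiff : ContDiff ℝ ∞ sqWeight := contDiff_norm_sq ℝ

/-! ### Spectral notions for an unbounded operator in a Hilbert space -/

variable {H : Type*} [NormedAddCommGroup H] [InnerProductSpace ℂ H]

/-- `μ` is in the resolvent set of `T` if `T - μ` maps the domain of `T` bijectively onto `H`,
with a bounded inverse `R`. -/
def resolventSet (T : H →ₗ.[ℂ] H) : Set ℂ :=
  {μ | ∃ R : H →L[ℂ] H,
    (∀ x : H, ∃ h : R x ∈ T.domain, T ⟨R x, h⟩ - μ • R x = x) ∧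
    ∀ y : T.domain, R (T y - μ • (y : H)) = y}

/-- The spectrum of `T`: the complement of the resolvent set. -/
def spec (T : H →ₗ.[ℂ] H) : Set ℂ := (resolventSet T)ᶜ

/-- The eigenspace `{x ∈ dom T | T x = μ x}`. -/
def eigenspace (T : H →ₗ.[ℂ] H) (μ : ℂ) : Submodule ℂ H where
  carrier := {x | ∃ h : x ∈ T.domain, T ⟨x, h⟩ = μ • x}
  zero_mem' := ⟨T.domain.zero_mem, by
    rw [smul_zero]
    exact T.map_zero⟩
  add_mem' := by
    rintro x y ⟨hx, ex⟩ ⟨hy, ey⟩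
    refine ⟨T.domain.add_mem hx hy, ?_⟩
    rw [smul_add, ← ex, ← ey]
    exact T.map_add ⟨x, hx⟩ ⟨y, hy⟩
  smul_mem' := by
    rintro c x ⟨hx, ex⟩
    refine ⟨T.domain.smul_mem c hx, ?_⟩
    rw [smul_comm, ← ex]
    exact T.map_smul c ⟨x, hx⟩

/-- The discrete spectrum of a self-adjoint operator: the isolated points of the spectrum that are
eigenvalues of finite multiplicity. -/
def discreteSpec (T : H →ₗ.[ℂ] H) : Set ℂ :=
  {μ | μ ∈ spec T ∧ (∃ ε > 0, ∀ ν ∈ spec T, dist ν μ < ε → ν = μ) ∧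
    eigenspace T μ ≠ ⊥ ∧ FiniteDimensional ℂ (eigenspace T μ)}

/-- The essential spectrum of a self-adjoint operator: the spectrum without the discrete
spectrum. -/
def essSpec (T : H →ₗ.[ℂ] H) : Set ℂ := spec T \ discreteSpec T

/-! ### The explicit polynomials -/

open scoped Nat ComplexConjugate

/-- The polynomial
`u_{k,m} = z̄^{k+m} z^m + ∑_{j=1}^m (-1)^j (k+m)! m! / (j! (k+m-j)! (m-j)!) z̄^{k+m-j} z^{m-j}`. -/
def uPoly (k m : ℕ) (z : ℂ) : ℂ :=
  conj z ^ (k + m) * z ^ m + ∑ j ∈ Finset.Icc 1 m,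
    ((-1) ^ j * ((k + m)! : ℂ) * (m ! : ℂ)) /
      ((j ! : ℂ) * ((k + m - j)! : ℂ) * ((m - j)! : ℂ)) *
      conj z ^ (k + m - j) * z ^ (m - j)

/-- The polynomial
`v_{k,m} = z̄^k z^{k+m} + ∑_{j=1}^k (-1)^j (k+m)! k! / (j! (k+m-j)! (k-j)!) z̄^{k-j} z^{k+m-j}`. -/
def vPoly (k m : ℕ) (z : ℂ) : ℂ :=
  conj z ^ k * z ^ (k + m) + ∑ j ∈ Finset.Icc 1 k,
    ((-1) ^ j * ((k + m)! : ℂ) * (k ! : ℂ)) /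
      ((j ! : ℂ) * ((k + m - j)! : ℂ) * ((k - j)! : ℂ)) *
      conj z ^ (k - j) * z ^ (k + m - j)

/-- The closed linear span of all `U k m` with `k + m = n` and all `V n m`. -/
def eigenfunctionSpan (U V : ℕ → ℕ → H) (n : ℕ) : Submodule ℂ H :=
  (Submodule.span ℂ
    ({x | ∃ k m, k + m = n ∧ x = U k m} ∪ {x | ∃ m, x = V n m})).topologicalClosure

end DbarNeumann

end

open DbarNeumann

namespace DbarNeumann

/-! ### Closed symmetric operators with a complete system of eigenvectors. -/

section Abstract

open Filter Topology
open scoped InnerProductSpace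

variable {H : Type*} [NormedAddCommGroup H] [InnerProductSpace ℂ H]

/-! Both Laplacians come from the expression `lap`, namely `-f_{z z̄} + z̄ f_{z̄}`: `box0` acts on
test functions as `lap`, and `box1` as `lap + 1`, because `∂̄(z̄ f) = f + z̄ f_{z̄}`. On monomials
`lap` is triangular: `z̄^a z^b` goes to `a z̄^a z^b - a b z̄^(a-1) z^(b-1)` (`lapPoly_mon`). Solving
the resulting recursion gives the complex Hermite polynomials `herm a b`, which satisfy `lap h = a
h` (`lapPoly_herm`); `u_{k,m}` and `v_{k,m}` are these same polynomials, indexed according to which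
exponent is larger.

Three facts turn this algebra into spectral theory. Polynomials lie in the domain of the closures,
which act on them by the same differential expression: smooth cutoffs converge in the graph norm
(`polyToL2_mem_graph_closure`). The operators are symmetric on test functions by integration by
parts (`inner_dbar_testToL2`). The Hermite polynomials span all polynomials (`span_herm`), and these
are dense in the Gaussian `L²` space by uniqueness of the Fourier transform
(`polyToL2_range_topologicalClosure`).

A closed symmetric operator with a total family of eigenvectors is multiplication by the eigenvalues
on a Hilbert sum. When the eigenvalues are separated from every other point, self-adjointness, the
spectrum and the exact eigenspaces can be read off
(`spectral_description_of_complete_eigenvectors`). Infinite multiplicity holds because, for fixed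
`a`, the `herm a b` have different weights under rotation of the plane (`linearIndependent_herm`).
-/

lemma mem_eigenspace_iff_graph {T : H →ₗ.[ℂ] H} {μ : ℂ} {x : H} :
    x ∈ eigenspace T μ ↔ (x, μ • x) ∈ T.graph := by
  rw [LinearPMap.mem_graph_iff]
  constructor
  · rintro ⟨h, e⟩
    exact ⟨⟨x, h⟩, rfl, e⟩
  · rintro ⟨⟨y, h⟩, rfl, e⟩
    exact ⟨h, e⟩

/-- On the graph, symmetry is a closed condition in each argument, so it can be carried over to
limits. -/
lemma isFormalAdjoint_self_iff_graph {T : H →ₗ.[ℂ] H} :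
    T.IsFormalAdjoint T ↔
      ∀ p ∈ T.graph, ∀ q ∈ T.graph, (inner ℂ p.2 q.1 : ℂ) = inner ℂ p.1 q.2 := by
  constructor
  · rintro h ⟨a, b⟩ hp ⟨c, d⟩ hq
    rw [LinearPMap.mem_graph_iff] at hp hq
    obtain ⟨x, rfl, rfl⟩ := hp
    obtain ⟨y, rfl, rfl⟩ := hq
    exact h x y
  · intro h x y
    exact h _ (T.mem_graph x) _ (T.mem_graph y)

/-- A densely defined symmetric operator is contained in its adjoint, which is closed. -/
lemma isClosable_of_isFormalAdjoint_self [CompleteSpace H] {T : H →ₗ.[ℂ] H}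
    (hd : Dense (T.domain : Set H)) (hs : T.IsFormalAdjoint T) : T.IsClosable :=
  (LinearPMap.adjoint_isClosed hd).isClosable.leIsClosable (hs.le_adjoint hd)

lemma isFormalAdjoint_self_closure {T : H →ₗ.[ℂ] H} (hc : T.IsClosable)
    (hs : T.IsFormalAdjoint T) : T.closure.IsFormalAdjoint T.closure := by
  rw [isFormalAdjoint_self_iff_graph, ← hc.graph_closure_eq_closure_graph] at *
  have h1 : ∀ p ∈ T.graph, ∀ q ∈ closure (T.graph : Set (H × H)),
      (inner ℂ p.2 q.1 : ℂ) = inner ℂ p.1 q.2 := fun p hp =>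
    closure_minimal (fun q hq => hs p hp q hq)
      (isClosed_eq (f := fun q : H × H => (inner ℂ p.2 q.1 : ℂ))
        (g := fun q : H × H => inner ℂ p.1 q.2) (by fun_prop) (by fun_prop))
  -- `h1` has passed to the limit in the second argument; the same is now done in the first.
  intro p hp q hq
  exact closure_minimal (s := (T.graph : Set (H × H)))
    (t := {p | (inner ℂ p.2 q.1 : ℂ) = inner ℂ p.1 q.2}) (fun p hp => h1 p hp q hq)
    (isClosed_eq (by fun_prop) (by fun_prop)) hp

/-- Multiplication by a bounded sequence of scalars on a Hilbert sum. -/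
lemma exists_diagonal {G : ℕ → Type*} [∀ n, NormedAddCommGroup (G n)]
    [∀ n, InnerProductSpace ℂ (G n)] (c : ℕ → ℂ) (C : ℝ) (hc : ∀ n, ‖c n‖ ≤ C) :
    ∃ D : lp G 2 →L[ℂ] lp G 2, ∀ v n, D v n = c n • v n := by
  have hC : 0 ≤ C := (norm_nonneg _).trans (hc 0)
  have hb : ∀ (v : lp G 2) n, ‖c n • v n‖ ^ (2 : ENNReal).toReal ≤
      C ^ 2 * ‖v n‖ ^ (2 : ENNReal).toReal := by
    intro v n
    simp only [ENNReal.toReal_ofNat, Real.rpow_ofNat]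
    rw [norm_smul, mul_pow]
    have := hc n
    gcongr
  have hsum : ∀ v : lp G 2, Summable fun n => C ^ 2 * ‖v n‖ ^ (2 : ENNReal).toReal := fun v =>
    ((lp.memℓp v).summable (by norm_num)).mul_left _
  have hmem : ∀ v : lp G 2, Memℓp (fun n => c n • v n) 2 := fun v =>
    memℓp_gen ((hsum v).of_nonneg_of_le (fun n => by positivity) (hb v))
  refine ⟨LinearMap.mkContinuous
    { toFun := fun v => ⟨fun n => c n • v n, hmem v⟩
      map_add' := fun v w => by
        ext n
        exact smul_add _ _ _
      map_smul' := fun a v => by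
        ext n
        exact smul_comm _ _ _ } C ?_, fun v n => rfl⟩
  intro v
  refine lp.norm_le_of_tsum_le (by norm_num) (by positivity) ?_
  have h2 : (C * ‖v‖) ^ (2 : ENNReal).toReal =
      ∑' n, C ^ 2 * ‖v n‖ ^ (2 : ENNReal).toReal := by
    rw [tsum_mul_left, ← lp.norm_rpow_eq_tsum (by norm_num) v]
    simp only [ENNReal.toReal_ofNat, Real.rpow_ofNat]
    ring
  rw [h2]
  exact ((hsum v).of_nonneg_of_le (fun n => by positivity) (hb v)).tsum_le_tsum (hb v) (hsum v)

/-- The closed span of a sequence of vectors. -/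
def closedSpan (e : ℕ → H) : Submodule ℂ H :=
  (Submodule.span ℂ (Set.range e)).topologicalClosure

lemma mem_closedSpan (e : ℕ → H) (b : ℕ) : e b ∈ closedSpan e :=
  Submodule.le_topologicalClosure _ (Submodule.subset_span ⟨b, rfl⟩)

instance [CompleteSpace H] (e : ℕ → H) : CompleteSpace (closedSpan e) :=
  (Submodule.isClosed_topologicalClosure _).completeSpace_coe

/-- An eigenspace of a closed operator is closed, being the preimage of the graph under the
continuous map `x ↦ (x, μ x)`. -/
lemma closedSpan_le_eigenspace {T : H →ₗ.[ℂ] H} (hcl : T.IsClosed) {μ : ℂ} {e : ℕ → H}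
    (he : ∀ b, e b ∈ eigenspace T μ) : closedSpan e ≤ eigenspace T μ := by
  refine Submodule.topologicalClosure_minimal _ (Submodule.span_le.2 ?_) ?_
  · rintro _ ⟨b, rfl⟩
    exact he b
  · have : (eigenspace T μ : Set H) = (fun x => (x, μ • x)) ⁻¹' (T.graph : Set (H × H)) := by
      ext x
      exact mem_eigenspace_iff_graph
    rw [this]
    exact hcl.preimage (by fun_prop)

lemma inner_eq_zero_of_mem_eigenspace {T : H →ₗ.[ℂ] H} (hs : T.IsFormalAdjoint T) {a b : ℝ}
    (hab : a ≠ b) {x y : H} (hx : x ∈ eigenspace T a) (hy : y ∈ eigenspace T b) :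
    (inner ℂ x y : ℂ) = 0 := by
  rw [mem_eigenspace_iff_graph] at hx hy
  have := isFormalAdjoint_self_iff_graph.1 hs _ hx _ hy
  simp only [inner_smul_left, inner_smul_right, Complex.conj_ofReal] at this
  have h2 : ((a : ℂ) - b) * inner ℂ x y = 0 := by rw [sub_mul, this, sub_self]
  refine (mul_eq_zero.1 h2).resolve_left ?_
  rw [← ne_eq, sub_ne_zero]
  exact_mod_cast hab

/-- A closed symmetric operator with a complete system of eigenvectors is, in the Hilbert sum
of the closed spans of the eigenvectors, the multiplication by the eigenvalues. -/
lemma exists_isHilbertSum_of_complete_eigenvectors [CompleteSpace H] {T : H →ₗ.[ℂ] H}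
    (hcl : T.IsClosed) (hs : T.IsFormalAdjoint T) {lam : ℕ → ℝ} (hinj : Function.Injective lam)
    {e : ℕ → ℕ → H} (he : ∀ n b, e n b ∈ eigenspace T (lam n))
    (htot : (Submodule.span ℂ (Set.range fun p : ℕ × ℕ => e p.1 p.2)).topologicalClosure = ⊤) :
    ∃ Φ : H ≃ₗᵢ[ℂ] lp (fun n => closedSpan (e n)) 2,
      (∀ x n, x ∈ closedSpan (e n) → ∀ m, m ≠ n → Φ x m = 0) ∧
      (∀ x n, (∀ m, m ≠ n → Φ x m = 0) → x ∈ closedSpan (e n)) ∧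
      ∀ y w, (y, w) ∈ T.graph ↔ ∀ n, Φ w n = (lam n : ℂ) • Φ y n := by
  have hle : ∀ n, closedSpan (e n) ≤ eigenspace T (lam n) := fun n =>
    closedSpan_le_eigenspace hcl (he n)
  have horth : OrthogonalFamily ℂ (fun n => closedSpan (e n))
      (fun n => (closedSpan (e n)).subtypeₗᵢ) := by
    intro m n hmn x y
    exact inner_eq_zero_of_mem_eigenspace hs (hinj.ne hmn) (hle m x.2) (hle n y.2)
  have hV : IsHilbertSum ℂ (fun n => closedSpan (e n))
      (fun n => (closedSpan (e n)).subtypeₗᵢ) := by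
    refine IsHilbertSum.mkInternal _ horth ?_
    rw [← htot]
    refine Submodule.topologicalClosure_mono (Submodule.span_le.2 ?_)
    rintro _ ⟨p, rfl⟩
    exact Submodule.mem_iSup_of_mem p.1 (mem_closedSpan _ _)
  set Φ := hV.linearIsometryEquiv with hΦ
  have hsingle : ∀ n (x : closedSpan (e n)), Φ x = lp.single 2 n x := by
    intro n x
    have := hV.linearIsometryEquiv_symm_apply_single x
    rw [← hΦ] at this
    rw [← LinearIsometryEquiv.apply_symm_apply Φ (lp.single 2 n x), this]
    rfl
  have hsum : ∀ x, HasSum (fun n => (Φ x n : H)) x := by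
    intro x
    have := hV.hasSum_linearIsometryEquiv_symm (Φ x)
    rw [← hΦ, LinearIsometryEquiv.symm_apply_apply] at this
    exact this
  have hinner : ∀ n (x : closedSpan (e n)) y,
      (inner ℂ (x : H) y : ℂ) = inner ℂ x (Φ y n) := by
    intro n x y
    rw [← LinearIsometryEquiv.inner_map_map Φ, hsingle, lp.inner_single_left]
  refine ⟨Φ, ?_, ?_, ?_⟩
  · intro x n hx m hm
    have := hsingle n ⟨x, hx⟩
    simp only at this
    rw [this, lp.single_apply, Pi.single_eq_of_ne hm]
  · intro x n h
    have h1 := (hsum x).unique (hasSum_single n fun m hm => by rw [h m hm]; rfl)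
    rw [h1]
    exact (Φ x n).2
  · intro y w
    constructor
    · intro h n
      -- Pairing with an eigenvector `x` and using symmetry moves the real eigenvalue from `x` onto
      -- the component of `y`.
      refine ext_inner_left ℂ fun x => ?_
      rw [← hinner, inner_smul_right, ← hinner]
      have := isFormalAdjoint_self_iff_graph.1 hs _
        (mem_eigenspace_iff_graph.1 (hle n x.2)) _ h
      simp only [inner_smul_left, Complex.conj_ofReal] at this
      exact this.symm
    · intro h
      -- The pair `(y, w)` is a limit of finite sums of eigenpairs, each in the graph, so closedness
      -- puts it in the graph too.
      have h2 : Tendsto (fun s : Finset ℕ => (∑ n ∈ s, (Φ y n : H), ∑ n ∈ s, (Φ w n : H)))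
          atTop (𝓝 (y, w)) := (hsum y).prodMk_nhds (hsum w)
      refine hcl.mem_of_tendsto h2 (Eventually.of_forall fun s => ?_)
      have h3 : (∑ n ∈ s, (Φ y n : H), ∑ n ∈ s, (Φ w n : H)) =
          ∑ n ∈ s, ((Φ y n : H), (Φ w n : H)) := by ext <;> simp [Prod.fst_sum, Prod.snd_sum]
      rw [h3]
      refine Submodule.sum_mem _ fun n _ => ?_
      rw [h n]
      exact mem_eigenspace_iff_graph.1 (hle n (Φ y n).2)

/-- The spectral description of a closed symmetric operator with a complete system of
eigenvectors for a separated sequence of eigenvalues. -/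
lemma spectral_description_of_complete_eigenvectors [CompleteSpace H] {T : H →ₗ.[ℂ] H}
    (hd : Dense (T.domain : Set H)) (hcl : T.IsClosed) (hs : T.IsFormalAdjoint T) {lam : ℕ → ℝ}
    (hinj : Function.Injective lam)
    (hsep : ∀ μ : ℂ, (∀ n, μ ≠ lam n) → ∃ δ > 0, ∀ n, δ ≤ ‖(lam n : ℂ) - μ‖)
    {e : ℕ → ℕ → H} (he : ∀ n b, e n b ∈ eigenspace T (lam n)) (hne : ∀ n, ∃ b, e n b ≠ 0)
    (htot : (Submodule.span ℂ (Set.range fun p : ℕ × ℕ => e p.1 p.2)).topologicalClosure = ⊤) :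
    IsSelfAdjoint T ∧ spec T = {μ : ℂ | ∃ n, μ = lam n} ∧
      ∀ n, eigenspace T (lam n) = closedSpan (e n) := by
  obtain ⟨Φ, hΦ1, hΦ2, hΦ⟩ := exists_isHilbertSum_of_complete_eigenvectors hcl hs hinj he htot
  have hle : ∀ n, closedSpan (e n) ≤ eigenspace T (lam n) := fun n =>
    closedSpan_le_eigenspace hcl (he n)
  refine ⟨?_, ?_, ?_⟩
  · rw [LinearPMap.isSelfAdjoint_def]
    refine le_antisymm (LinearPMap.le_of_le_graph ?_) (hs.le_adjoint hd)
    rintro ⟨y, w⟩ h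
    rw [hΦ]
    intro n
    rw [LinearPMap.adjoint_graph_eq_graph_adjoint hd, Submodule.mem_adjoint_iff] at h
    -- For `(y, w)` in the graph of the adjoint, `u` is the `n`-th defect `w_n - lam n • y_n`,
    -- itself an eigenvector. Testing the adjoint relation against `u` gives `‖u‖² = 0`.
    set u : H := Φ.symm (lp.single 2 n (Φ w n - (lam n : ℂ) • Φ y n)) with hu
    have hΦu : Φ u = lp.single 2 n (Φ w n - (lam n : ℂ) • Φ y n) := by rw [hu]; simp
    have hmem : (u, (lam n : ℂ) • u) ∈ T.graph := by
      refine mem_eigenspace_iff_graph.1 (hle n (hΦ2 u n fun m hm => ?_))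
      rw [hΦu, lp.single_apply, Pi.single_eq_of_ne hm]
    have h3 := h _ _ hmem
    rw [inner_smul_left, Complex.conj_ofReal, ← LinearIsometryEquiv.inner_map_map Φ,
      ← LinearIsometryEquiv.inner_map_map Φ u w, hΦu, lp.inner_single_left,
      lp.inner_single_left, ← inner_smul_right, ← inner_sub_right, ← neg_sub (Φ w n),
      inner_neg_right, neg_eq_zero, inner_self_eq_zero, sub_eq_zero] at h3
    exact h3
  · ext μ
    simp only [spec, Set.mem_compl_iff, Set.mem_ofPred_eq]
    rw [← not_iff_not, not_not]
    push Not
    constructor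
    -- At an eigenvalue, a left inverse of `T - μ` would have to send `0` to a nonzero eigenvector.
    · rintro ⟨R, -, h⟩ n rfl
      obtain ⟨b, hb⟩ := hne n
      obtain ⟨hd, hT⟩ := he n b
      have := h ⟨e n b, hd⟩
      rw [hT, sub_self, map_zero] at this
      exact hb this.symm
    · intro hμ
      obtain ⟨δ, hδ, hsep⟩ := hsep μ hμ
      have hne0 : ∀ n, (lam n : ℂ) - μ ≠ 0 := fun n => by
        rw [sub_ne_zero]
        exact (hμ n).symm
      -- The resolvent is diagonal with entries `(lam n - μ)⁻¹`; the separation `δ` bounds them by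
      -- `δ⁻¹`.
      obtain ⟨D, hD⟩ := exists_diagonal (G := fun n => closedSpan (e n))
        (fun n => ((lam n : ℂ) - μ)⁻¹) δ⁻¹ (fun n => by
          rw [norm_inv]
          exact inv_anti₀ hδ (hsep n))
      refine ⟨Φ.symm.toContinuousLinearEquiv.toContinuousLinearMap ∘L D ∘L
        Φ.toContinuousLinearEquiv.toContinuousLinearMap, ?_, ?_⟩
      · intro x
        have : (Φ.symm (D (Φ x)), x + μ • Φ.symm (D (Φ x))) ∈ T.graph := by
          rw [hΦ]
          intro n
          have h1 : Φ (x + μ • Φ.symm (D (Φ x))) n = Φ x n + μ • D (Φ x) n := by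
            rw [map_add, map_smul, LinearIsometryEquiv.apply_symm_apply]
            rfl
          rw [h1, LinearIsometryEquiv.apply_symm_apply, hD, smul_smul, smul_smul]
          nth_rw 1 [← one_smul ℂ (Φ x n)]
          rw [← add_smul]
          congr 1
          field_simp [hne0 n]
          ring
        rw [LinearPMap.mem_graph_iff] at this
        obtain ⟨⟨y, hy⟩, h1, h2⟩ := this
        simp only at h1
        subst h1
        exact ⟨hy, by
          change T ⟨_, hy⟩ - μ • Φ.symm (D (Φ x)) = x
          rw [h2]
          simp⟩
      · intro y
        change Φ.symm (D (Φ (T y - μ • (y : H)))) = y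
        rw [LinearIsometryEquiv.symm_apply_eq]
        ext1
        funext n
        rw [hD]
        have h1 := (hΦ _ _).1 (T.mem_graph y) n
        have h2 : Φ (T y - μ • (y : H)) n = Φ (T y) n - μ • Φ y n := by
          rw [map_sub, map_smul]
          rfl
        rw [h2, h1, ← sub_smul, smul_smul, inv_mul_cancel₀ (hne0 n), one_smul]
  · intro n
    refine le_antisymm (fun x hx => ?_) (hle n)
    -- In coordinates the eigenvalue equation reads `(lam n - lam m) • x_m = 0`, so injectivity of
    -- `lam` leaves only the `n`-th component.
    refine hΦ2 x n fun m hm => ?_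
    have h1 := (hΦ _ _).1 (mem_eigenspace_iff_graph.1 hx) m
    have h2 : Φ ((lam n : ℂ) • x) m = (lam n : ℂ) • Φ x m := by
      rw [map_smul]
      rfl
    rw [h2, ← sub_eq_zero, ← sub_smul, smul_eq_zero, sub_eq_zero] at h1
    refine h1.resolve_left ?_
    exact_mod_cast hinj.ne hm.symm

end Abstract

/-! ### Calculus of the Wirtinger derivatives. -/

section Wirtinger

open Complex
open scoped ComplexConjugate

variable {f g : ℂ → ℂ} {z : ℂ}

lemma dz_congr (h : f =ᶠ[nhds z] g) : dz f z = dz g z := by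
  simp only [dz, h.fderiv_eq]

lemma dbar_congr (h : f =ᶠ[nhds z] g) : dbar f z = dbar g z := by
  simp only [dbar, h.fderiv_eq]

lemma dz_add (hf : DifferentiableAt ℝ f z) (hg : DifferentiableAt ℝ g z) :
    dz (f + g) z = dz f z + dz g z := by
  simp only [dz, fderiv_add hf hg, add_apply]
  ring

lemma dbar_add (hf : DifferentiableAt ℝ f z) (hg : DifferentiableAt ℝ g z) :
    dbar (f + g) z = dbar f z + dbar g z := by
  simp only [dbar, fderiv_add hf hg, add_apply]
  ring

lemma dz_neg : dz (-f) z = -dz f z := by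
  simp only [dz, fderiv_neg, neg_apply]
  ring

lemma dbar_neg : dbar (-f) z = -dbar f z := by
  simp only [dbar, fderiv_neg, neg_apply]
  ring

lemma dz_const_smul (c : ℂ) (hf : DifferentiableAt ℝ f z) : dz (c • f) z = c * dz f z := by
  simp only [dz, fderiv_const_smul hf, smul_apply, smul_eq_mul]
  ring

lemma dbar_const_smul (c : ℂ) (hf : DifferentiableAt ℝ f z) :
    dbar (c • f) z = c * dbar f z := by
  simp only [dbar, fderiv_const_smul hf, smul_apply, smul_eq_mul]
  ring

lemma dz_mul (hf : DifferentiableAt ℝ f z) (hg : DifferentiableAt ℝ g z) :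
    dz (f * g) z = dz f z * g z + f z * dz g z := by
  simp only [dz, fderiv_mul hf hg, add_apply, smul_apply, smul_eq_mul]
  ring

lemma dbar_mul (hf : DifferentiableAt ℝ f z) (hg : DifferentiableAt ℝ g z) :
    dbar (f * g) z = dbar f z * g z + f z * dbar g z := by
  simp only [dbar, fderiv_mul hf hg, add_apply, smul_apply, smul_eq_mul]
  ring

lemma dz_cexp (hf : DifferentiableAt ℝ f z) :
    dz (fun w => cexp (f w)) z = cexp (f z) * dz f z := by
  simp only [dz, hf.hasFDerivAt.cexp.fderiv, smul_apply, smul_eq_mul]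
  ring

lemma fderiv_comp_real_smul (c : ℝ) (hf : Differentiable ℝ f) (v : ℂ) :
    fderiv ℝ (fun w => f (c • w)) z v = c * fderiv ℝ f (c • z) v := by
  have h : HasFDerivAt (fun w : ℂ => c • w) (c • ContinuousLinearMap.id ℝ ℂ) z :=
    (hasFDerivAt_id z).const_smul c
  have h3 : fderiv ℝ (fun w => f (c • w)) z = _ := ((hf (c • z)).hasFDerivAt.comp z h).fderiv
  rw [h3, ContinuousLinearMap.comp_apply, smul_apply, ContinuousLinearMap.id_apply, map_smul,
    real_smul]

lemma dz_comp_real_smul (c : ℝ) (hf : Differentiable ℝ f) :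
    dz (fun w => f (c • w)) z = c * dz f (c • z) := by
  rw [dz, fderiv_comp_real_smul c hf, fderiv_comp_real_smul c hf, dz]
  ring

lemma dbar_comp_real_smul (c : ℝ) (hf : Differentiable ℝ f) :
    dbar (fun w => f (c • w)) z = c * dbar f (c • z) := by
  rw [dbar, fderiv_comp_real_smul c hf, fderiv_comp_real_smul c hf, dbar]
  ring

lemma fderiv_conj_comp (hf : DifferentiableAt ℝ f z) (v : ℂ) :
    fderiv ℝ (fun w => conj (f w)) z v = conj (fderiv ℝ f z v) := by
  have h := (conjCLE.toContinuousLinearMap.hasFDerivAt (x := f z)).comp z hf.hasFDerivAt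
  have h2 : fderiv ℝ (fun w => conj (f w)) z = _ := h.fderiv
  rw [h2]
  rfl

lemma dz_conj_comp (hf : DifferentiableAt ℝ f z) :
    dz (fun w => conj (f w)) z = conj (dbar f z) := by
  simp only [dz, dbar, fderiv_conj_comp hf, map_mul, map_add, map_div₀, map_one, map_ofNat, conj_I]
  ring

lemma dz_of_hasDerivAt {f' : ℂ} (h : HasDerivAt f f' z) : dz f z = f' := by
  have h2 : fderiv ℝ f z = _ := (h.hasFDerivAt.restrictScalars ℝ).fderiv
  simp [dz, h2]
  linear_combination (-1 / 2 * f') * I_mul_I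

lemma dbar_of_hasDerivAt {f' : ℂ} (h : HasDerivAt f f' z) : dbar f z = 0 := by
  have h2 : fderiv ℝ f z = _ := (h.hasFDerivAt.restrictScalars ℝ).fderiv
  simp [dbar, h2]
  linear_combination f' * I_mul_I

lemma dbar_conj_comp (hf : DifferentiableAt ℝ f z) :
    dbar (fun w => conj (f w)) z = conj (dz f z) := by
  simp only [dz, dbar, fderiv_conj_comp hf, map_mul, map_sub, map_div₀, map_one, map_ofNat, conj_I]
  ring

/-- This is the symmetry of the second real derivative in the directions `1` and `I`. -/
lemma dbar_dz_comm (hf : ContDiff ℝ ∞ f) : dbar (dz f) z = dz (dbar f) z := by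
  have h1 : ∀ v : ℂ, Differentiable ℝ fun w => fderiv ℝ f w v := fun v =>
    (contDiff_fderiv_apply hf v).differentiable (by simp)
  have hd : DifferentiableAt ℝ (fderiv ℝ f) z :=
    ((hf.fderiv_right (m := ∞) (by simp)).differentiable (by simp)) z
  have h2 : ∀ v w : ℂ, fderiv ℝ (fun w => fderiv ℝ f w v) z w = fderiv ℝ (fderiv ℝ f) z w v := by
    intro v w
    rw [fderiv_clm_apply hd (differentiableAt_const v)]
    simp
  have hsymm : fderiv ℝ (fderiv ℝ f) z 1 I = fderiv ℝ (fderiv ℝ f) z I 1 :=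
    (hf.contDiffAt.isSymmSndFDerivAt (by
      simpa using WithTop.coe_le_coe.2 (le_top : (2 : ℕ∞) ≤ ⊤))) 1 I
  have e1 : dz f = (1 / 2 : ℂ) • ((fun w => fderiv ℝ f w 1) - I • fun w => fderiv ℝ f w I) := by
    ext w
    simp [dz]
  have e2 : dbar f =
      (1 / 2 : ℂ) • ((fun w => fderiv ℝ f w 1) + I • fun w => fderiv ℝ f w I) := by
    ext w
    simp [dbar]
  have k1 := h1 1 z
  have k2 := (h1 I z).const_smul I
  rw [e1, e2, dbar_const_smul _ (k1.sub k2), dz_const_smul _ (k1.add k2)]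
  simp only [dz, dbar, fderiv_sub k1 k2, fderiv_add k1 k2, fderiv_const_smul (h1 I z), h2,
    add_apply, sub_apply, smul_apply, smul_eq_mul, hsymm]
  ring

end Wirtinger

/-! ### Polynomials in `z` and `z̄`, and the expression `lap`. -/

section Monomials

open Complex
open scoped ComplexConjugate

/-- The monomial `z̄^a z^b`. -/
def mon (a b : ℕ) (z : ℂ) : ℂ := conj z ^ a * z ^ b

lemma contDiff_conj : ContDiff ℝ ∞ fun z : ℂ => conj z :=
  conjCLE.toContinuousLinearMap.contDiff

lemma contDiff_mon (a b : ℕ) : ContDiff ℝ ∞ (mon a b) :=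
  (contDiff_conj.pow a).mul (contDiff_id.pow b)

lemma dz_mon (a b : ℕ) : dz (mon a b) = (b : ℂ) • mon a (b - 1) := by
  ext z
  have h1 : DifferentiableAt ℝ (fun z : ℂ => conj z ^ a) z :=
    (contDiff_conj.pow a).differentiable (by simp) z
  have h2 : DifferentiableAt ℝ (fun z : ℂ => z ^ b) z := by fun_prop
  have h4 : DifferentiableAt ℝ (fun z : ℂ => z ^ a) z := by fun_prop
  have h3 : dz (fun z : ℂ => conj z ^ a) z = 0 := by
    have := dz_conj_comp h4
    simp only [map_pow] at this
    rw [this, dbar_of_hasDerivAt (hasDerivAt_pow a z), map_zero]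
  have := dz_mul h1 h2
  rw [h3, dz_of_hasDerivAt (hasDerivAt_pow b z)] at this
  refine this.trans ?_
  simp [mon]
  ring

lemma dbar_mon (a b : ℕ) : dbar (mon a b) = (a : ℂ) • mon (a - 1) b := by
  ext z
  have h1 : DifferentiableAt ℝ (fun z : ℂ => conj z ^ a) z :=
    (contDiff_conj.pow a).differentiable (by simp) z
  have h2 : DifferentiableAt ℝ (fun z : ℂ => z ^ b) z := by fun_prop
  have h4 : DifferentiableAt ℝ (fun z : ℂ => z ^ a) z := by fun_prop
  have h3 : dbar (fun z : ℂ => conj z ^ a) z = a * conj z ^ (a - 1) := by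
    have := dbar_conj_comp h4
    simp only [map_pow] at this
    rw [this, dz_of_hasDerivAt (hasDerivAt_pow a z)]
    simp
  have := dbar_mul h1 h2
  rw [h3, dbar_of_hasDerivAt (hasDerivAt_pow b z)] at this
  refine this.trans ?_
  simp [mon]
  ring

/-- The polynomials in `z` and `z̄`. -/
def polys : Submodule ℂ (ℂ → ℂ) := Submodule.span ℂ (Set.range fun p : ℕ × ℕ => mon p.1 p.2)

lemma mon_mem_polys (a b : ℕ) : mon a b ∈ polys := Submodule.subset_span ⟨(a, b), rfl⟩

lemma contDiff_of_mem_polys {p : ℂ → ℂ} (hp : p ∈ polys) : ContDiff ℝ ∞ p := by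
  induction hp using Submodule.span_induction with
  | mem x h =>
    obtain ⟨p, rfl⟩ := h
    exact contDiff_mon _ _
  | zero => exact contDiff_const
  | add x y _ _ hx hy => exact hx.add hy
  | smul c x _ hx => exact contDiff_const.smul hx

lemma differentiable_of_mem_polys {p : ℂ → ℂ} (hp : p ∈ polys) : Differentiable ℝ p :=
  (contDiff_of_mem_polys hp).differentiable (by simp)

lemma dz_mem_polys {p : ℂ → ℂ} (hp : p ∈ polys) : dz p ∈ polys := by
  induction hp using Submodule.span_induction with
  | mem x h =>
    obtain ⟨p, rfl⟩ := h
    rw [dz_mon]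
    exact polys.smul_mem _ (mon_mem_polys _ _)
  | zero =>
    have : dz 0 = 0 := by
      ext z
      simp [dz]
    rw [this]
    exact polys.zero_mem
  | add x y hx' hy' hx hy =>
    have : dz (x + y) = dz x + dz y := funext fun z =>
      dz_add (differentiable_of_mem_polys hx' z) (differentiable_of_mem_polys hy' z)
    rw [this]
    exact polys.add_mem hx hy
  | smul c x hx' hx =>
    have : dz (c • x) = c • dz x := funext fun z =>
      dz_const_smul c (differentiable_of_mem_polys hx' z)
    rw [this]
    exact polys.smul_mem _ hx

lemma dbar_mem_polys {p : ℂ → ℂ} (hp : p ∈ polys) : dbar p ∈ polys := by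
  induction hp using Submodule.span_induction with
  | mem x h =>
    obtain ⟨p, rfl⟩ := h
    rw [dbar_mon]
    exact polys.smul_mem _ (mon_mem_polys _ _)
  | zero =>
    have : dbar 0 = 0 := by
      ext z
      simp [dbar]
    rw [this]
    exact polys.zero_mem
  | add x y hx' hy' hx hy =>
    have : dbar (x + y) = dbar x + dbar y := funext fun z =>
      dbar_add (differentiable_of_mem_polys hx' z) (differentiable_of_mem_polys hy' z)
    rw [this]
    exact polys.add_mem hx hy
  | smul c x hx' hx =>
    have : dbar (c • x) = c • dbar x := funext fun z =>
      dbar_const_smul c (differentiable_of_mem_polys hx' z)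
    rw [this]
    exact polys.smul_mem _ hx

/-- A crude growth bound, from `r^n ≤ n! e^r`; it is enough both for square integrability against
the Gaussian and for dominated convergence. -/
lemma norm_le_exp_of_mem_polys {p : ℂ → ℂ} (hp : p ∈ polys) :
    ∃ C, 0 ≤ C ∧ ∀ z, ‖p z‖ ≤ C * Real.exp ‖z‖ := by
  induction hp using Submodule.span_induction with
  | mem x h =>
    obtain ⟨⟨a, b⟩, rfl⟩ := h
    refine ⟨(a + b).factorial, by positivity, fun z => ?_⟩
    have := Real.pow_div_factorial_le_exp ‖z‖ (norm_nonneg z) (a + b)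
    rw [div_le_iff₀ (by positivity), mul_comm] at this
    simpa [mon, ← pow_add] using this
  | zero => exact ⟨0, le_rfl, by simp⟩
  | add x y _ _ hx hy =>
    obtain ⟨C, hC, h⟩ := hx
    obtain ⟨D, hD, k⟩ := hy
    refine ⟨C + D, by positivity, fun z => (norm_add_le _ _).trans ?_⟩
    rw [add_mul]
    exact add_le_add (h z) (k z)
  | smul c x _ hx =>
    obtain ⟨C, hC, h⟩ := hx
    refine ⟨‖c‖ * C, by positivity, fun z => ?_⟩
    rw [Pi.smul_apply, norm_smul, mul_assoc]
    exact mul_le_mul_of_nonneg_left (h z) (norm_nonneg _)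

lemma sqWeight_eq_mon (z : ℂ) : (sqWeight z : ℂ) = mon 1 1 z := by
  simp only [sqWeight, mon, pow_one]
  rw [mul_comm, mul_conj, normSq_eq_norm_sq]

lemma dz_sqWeight (z : ℂ) : dz (fun w => (sqWeight w : ℂ)) z = conj z := by
  have : (fun w => (sqWeight w : ℂ)) = mon 1 1 := funext sqWeight_eq_mon
  rw [this, dz_mon]
  simp [mon]

/-- The differential expression `-f_{z z̄} + z̄ f_{z̄}`. -/
noncomputable def lap (f : ℂ → ℂ) (z : ℂ) : ℂ := -dz (dbar f) z + conj z * dbar f z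

lemma dbarStar_dbar (f : ℂ → ℂ) (z : ℂ) : dbarStar sqWeight (dbar f) z = lap f z := by
  simp only [dbarStar, lap, dz_sqWeight]
  ring

/-- The extra `f` is the commutator of `∂̄` with multiplication by `z̄`; the second-order terms
agree because `∂̄` and `∂` commute. -/
lemma dbar_dbarStar {f : ℂ → ℂ} (hf : ContDiff ℝ ∞ f) (z : ℂ) :
    dbar (dbarStar sqWeight f) z = lap f z + f z := by
  have e : dbarStar sqWeight f = -(dz f) + (fun w : ℂ => conj w) * f := by
    ext w
    simp only [dbarStar, dz_sqWeight, Pi.add_apply, Pi.neg_apply, Pi.mul_apply]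
    ring
  have hc : DifferentiableAt ℝ (fun w : ℂ => conj w) z := contDiff_conj.differentiable (by simp) z
  have hf' : DifferentiableAt ℝ f z := hf.differentiable (by simp) z
  have h1 : DifferentiableAt ℝ (dz f) z := (contDiff_dz hf).differentiable (by simp) z
  have h2 : dbar (fun w : ℂ => conj w) z = 1 := by
    have : (fun w : ℂ => conj w) = mon 1 0 := by
      ext w
      simp [mon]
    rw [this, dbar_mon]
    simp [mon]
  rw [e, dbar_add h1.neg (hc.mul hf'), dbar_neg, dbar_mul hc hf', h2, dbar_dz_comm hf, lap]
  ring

lemma mon_mul_mem_polys (c d : ℕ) {q : ℂ → ℂ} (hq : q ∈ polys) : mon c d * q ∈ polys := by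
  induction hq using Submodule.span_induction with
  | mem x h =>
    obtain ⟨⟨a, b⟩, rfl⟩ := h
    convert mon_mem_polys (c + a) (d + b) using 1
    ext z
    simp [mon]
    ring
  | zero =>
    rw [mul_zero]
    exact polys.zero_mem
  | add x y _ _ hx hy =>
    rw [mul_add]
    exact polys.add_mem hx hy
  | smul c x _ hx =>
    rw [mul_smul_comm]
    exact polys.smul_mem c hx

lemma lap_mem_polys {p : ℂ → ℂ} (hp : p ∈ polys) : lap p ∈ polys := by
  convert polys.add_mem (polys.neg_mem (dz_mem_polys (dbar_mem_polys hp)))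
    (mon_mul_mem_polys 1 0 (dbar_mem_polys hp)) using 1
  ext z
  simp [lap, mon]

lemma lap_mul {f g : ℂ → ℂ} (hf : ContDiff ℝ ∞ f) (hg : ContDiff ℝ ∞ g) (z : ℂ) :
    lap (f * g) z = f z * lap g z + lap f z * g z - dbar f z * dz g z - dz f z * dbar g z := by
  have d : ∀ {h : ℂ → ℂ}, ContDiff ℝ ∞ h → Differentiable ℝ h := fun hh =>
    hh.differentiable (by simp)
  have e : dbar (f * g) = dbar f * g + f * dbar g := funext fun w => dbar_mul (d hf w) (d hg w)
  have h1 := d (contDiff_dbar hf)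
  have h2 := d (contDiff_dbar hg)
  simp only [lap]
  rw [e, dz_add ((h1 z).mul (d hg z)) ((d hf z).mul (h2 z)), dz_mul (h1 z) (d hg z),
    dz_mul (d hf z) (h2 z)]
  simp only [Pi.add_apply, Pi.mul_apply]
  ring

end Monomials

/-! ### Integration and symmetry in the Gaussian `L²` space. -/

section GaussianSpace

open MeasureTheory Complex Filter Topology
open scoped ComplexConjugate

lemma measurable_gaussianDensity :
    Measurable fun z => ENNReal.ofReal (Real.exp (-sqWeight z)) :=
  ENNReal.measurable_ofReal.comp
    (Real.continuous_exp.comp sqWeight_contDiff.continuous.neg).measurable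

lemma integral_weightMeasure (f : ℂ → ℂ) :
    ∫ z, f z ∂weightMeasure sqWeight = ∫ z, cexp (-(sqWeight z : ℂ)) * f z := by
  rw [weightMeasure, integral_withDensity_eq_integral_toReal_smul measurable_gaussianDensity
    (Eventually.of_forall fun z => ENNReal.ofReal_lt_top)]
  refine integral_congr_ae (Eventually.of_forall fun z => ?_)
  simp only [ENNReal.toReal_ofReal (Real.exp_pos _).le, real_smul]
  push_cast
  rfl

lemma memLp_exp_norm (k : ℝ) :
    MemLp (fun z : ℂ => Real.exp (k * ‖z‖)) 2 (weightMeasure sqWeight) := by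
  have hc : Continuous fun z : ℂ => Real.exp (k * ‖z‖) := by fun_prop
  rw [memLp_two_iff_integrable_sq hc.aestronglyMeasurable, weightMeasure,
    integrable_withDensity_iff_integrable_smul' measurable_gaussianDensity
      (Eventually.of_forall fun z => ENNReal.ofReal_lt_top)]
  have h0 : Integrable fun z : ℂ => Real.exp (-(1 / 2) * ‖z‖ ^ 2) := by
    have := (GaussianFourier.integrable_cexp_neg_mul_sq_norm_add (V := ℂ) (b := 1 / 2)
      (by norm_num) 0 0).norm
    refine this.congr (Eventually.of_forall fun z => ?_)
    simp only [norm_exp]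
    congr 1
    have : (-(1 / 2) * (‖z‖ : ℂ) ^ 2 + 0 * ((inner ℝ (0 : ℂ) z : ℝ) : ℂ)) =
      ((-(1 / 2) * ‖z‖ ^ 2 : ℝ) : ℂ) := by push_cast; ring
    rw [this, ofReal_re]
  -- Completing the square: `2k|z| - |z|² ≤ 2k² - |z|²/2`, which is `(|z| - 2k)² ≥ 0`.
  refine (h0.const_mul (Real.exp (2 * k ^ 2))).mono' ?_ (Eventually.of_forall fun z => ?_)
  · exact (measurable_gaussianDensity.ennreal_toReal.aestronglyMeasurable).smul
      (hc.pow 2).aestronglyMeasurable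
  · rw [ENNReal.toReal_ofReal (Real.exp_pos _).le, smul_eq_mul, ← Real.exp_nat_mul,
      ← Real.exp_add, ← Real.exp_add, Real.norm_eq_abs, abs_of_pos (Real.exp_pos _),
      Real.exp_le_exp, sqWeight]
    push_cast
    nlinarith [sq_nonneg (‖z‖ - 2 * k)]

lemma memLp_of_norm_le_exp {f : ℂ → ℂ} (hf : Continuous f) {C k : ℝ}
    (h : ∀ z, ‖f z‖ ≤ C * Real.exp (k * ‖z‖)) : MemLp f 2 (weightMeasure sqWeight) :=
  ((memLp_exp_norm k).const_mul C).mono' hf.aestronglyMeasurable (Eventually.of_forall h)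

lemma memLp_of_mem_polys {p : ℂ → ℂ} (hp : p ∈ polys) : MemLp p 2 (weightMeasure sqWeight) := by
  obtain ⟨C, -, h⟩ := norm_le_exp_of_mem_polys hp
  exact memLp_of_norm_le_exp (contDiff_of_mem_polys hp).continuous
    (k := 1) (fun z => by simpa using h z)

lemma tendsto_toLp_of_dominated {α : Type*} [MeasurableSpace α] {μ : Measure α}
    {F : ℕ → α → ℂ} {f : α → ℂ} (hF : ∀ n, MemLp (F n) 2 μ) (hf : MemLp f 2 μ) {g : α → ℝ}
    (hg : MemLp g 2 μ) (hb : ∀ n a, ‖F n a‖ ≤ g a)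
    (hlim : ∀ a, Tendsto (fun n => F n a) atTop (𝓝 (f a))) :
    Tendsto (fun n => (hF n).toLp (F n)) atTop (𝓝 (hf.toLp f)) := by
  rw [Lp.tendsto_Lp_iff_tendsto_eLpNorm'']
  simp_rw [eLpNorm_eq_lintegral_rpow_enorm_toReal two_ne_zero ENNReal.ofNat_ne_top]
  have hg2 : MemLp (fun a => 2 * g a) 2 μ := hg.const_mul 2
  have h1 : Tendsto (fun n => ∫⁻ a, ‖(F n - f) a‖ₑ ^ (2 : ENNReal).toReal ∂μ) atTop
      (𝓝 (∫⁻ _, 0 ∂μ)) := by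
    -- The limit also satisfies `‖f‖ ≤ g`, so `‖F n - f‖²` is dominated by the integrable `(2g)²`.
    refine tendsto_lintegral_of_dominated_convergence'
      (fun a => ‖2 * g a‖ₑ ^ (2 : ENNReal).toReal) (fun n => ?_) (fun n => ?_) ?_ ?_
    · exact ((hF n).sub hf).aestronglyMeasurable.enorm.pow_const _
    · refine Eventually.of_forall fun a => ENNReal.rpow_le_rpow ?_ (by norm_num)
      rw [enorm_le_iff_norm_le]
      have h2 : ‖f a‖ ≤ g a := le_of_tendsto (hlim a).norm (Eventually.of_forall fun n => hb n a)
      calc ‖F n a - f a‖ ≤ ‖F n a‖ + ‖f a‖ := norm_sub_le _ _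
        _ ≤ 2 * g a := by linarith [hb n a]
        _ ≤ ‖2 * g a‖ := Real.le_norm_self _
    · exact (lintegral_rpow_enorm_lt_top_of_eLpNorm_lt_top two_ne_zero ENNReal.ofNat_ne_top
        hg2.2).ne
    · refine Eventually.of_forall fun a => ?_
      have h2 : Tendsto (fun n => F n a - f a) atTop (𝓝 0) := by
        simpa using (hlim a).sub_const (f a)
      have h3 := (ENNReal.continuous_rpow_const (y := (2 : ENNReal).toReal)).tendsto 0 |>.comp
        ((continuous_enorm.tendsto (0 : ℂ)).comp h2 |>.trans (by simp))
      simpa [Function.comp_def] using h3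
  have h4 := ((ENNReal.continuous_rpow_const (y := 1 / (2 : ENNReal).toReal)).tendsto _).comp h1
  simpa [Function.comp_def] using h4

lemma integrable_test {f : ℂ → ℂ} (hf : f ∈ testFunctions) : Integrable f :=
  hf.1.continuous.integrable_of_hasCompactSupport hf.2

lemma integral_mul_fderiv_test {f g : ℂ → ℂ} (hf : f ∈ testFunctions) (hg : g ∈ testFunctions)
    (v : ℂ) : ∫ z, f z * fderiv ℝ g z v = -∫ z, fderiv ℝ f z v * g z := by
  have hf' := contDiff_fderiv_apply hf.1 v
  have hg' := contDiff_fderiv_apply hg.1 v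
  refine integral_mul_fderiv_eq_neg_fderiv_mul_of_integrable ?_ ?_ ?_
    (fun z _ => differentiable_of_mem hf z) (fun z _ => differentiable_of_mem hg z)
  · exact integrable_test ⟨hf'.mul hg.1, hg.2.mul_left⟩
  · exact integrable_test ⟨hf.1.mul hg', hf.2.mul_right⟩
  · exact integrable_test ⟨hf.1.mul hg.1, hf.2.mul_right⟩

lemma integral_mul_dz_test {f g : ℂ → ℂ} (hf : f ∈ testFunctions) (hg : g ∈ testFunctions) :
    ∫ z, f z * dz g z = -∫ z, dz f z * g z := by
  have i1 : ∀ v : ℂ, Integrable fun z => f z * fderiv ℝ g z v := fun v =>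
    integrable_test ⟨hf.1.mul (contDiff_fderiv_apply hg.1 v), hf.2.mul_right⟩
  have i2 : ∀ v : ℂ, Integrable fun z => fderiv ℝ f z v * g z := fun v =>
    integrable_test ⟨(contDiff_fderiv_apply hf.1 v).mul hg.1, hg.2.mul_left⟩
  have e1 : ∀ z, f z * dz g z =
      (1 / 2) * (f z * fderiv ℝ g z 1 - I * (f z * fderiv ℝ g z I)) := fun z => by
    rw [dz]
    ring
  have e2 : ∀ z, dz f z * g z =
      (1 / 2) * (fderiv ℝ f z 1 * g z - I * (fderiv ℝ f z I * g z)) := fun z => by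
    rw [dz]
    ring
  simp_rw [e1, e2]
  rw [integral_const_mul, integral_const_mul, integral_sub (i1 1) ((i1 I).const_mul I),
    integral_sub (i2 1) ((i2 I).const_mul I), integral_const_mul, integral_const_mul,
    integral_mul_fderiv_test hf hg, integral_mul_fderiv_test hf hg]
  ring

lemma inner_testToL2 (f g : testFunctions) :
    (inner ℂ (testToL2 sqWeight sqWeight_contDiff f) (testToL2 sqWeight sqWeight_contDiff g) : ℂ) =
      ∫ z, cexp (-(sqWeight z : ℂ)) * (conj (f.1 z) * g.1 z) := by
  rw [← integral_weightMeasure, L2.inner_def]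
  refine integral_congr_ae ?_
  filter_upwards [(memLp_test sqWeight_contDiff f.2).coeFn_toLp,
    (memLp_test sqWeight_contDiff g.2).coeFn_toLp] with z h1 h2
  change inner ℂ (((memLp_test sqWeight_contDiff f.2).toLp f.1) z)
    (((memLp_test sqWeight_contDiff g.2).toLp g.1) z) = _
  rw [h1, h2, RCLike.inner_apply, mul_comm]

lemma contDiff_gaussian : ContDiff ℝ ∞ fun z => cexp (-(sqWeight z : ℂ)) :=
  (ofRealCLM.contDiff.comp sqWeight_contDiff).neg.cexp

lemma dz_gaussian (z : ℂ) :
    dz (fun z => cexp (-(sqWeight z : ℂ))) z = cexp (-(sqWeight z : ℂ)) * -conj z := by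
  have hd : DifferentiableAt ℝ (fun z => (sqWeight z : ℂ)) z :=
    (ofRealCLM.contDiff.comp sqWeight_contDiff).differentiable (n := ∞) (by simp) z
  rw [dz_cexp (f := fun z => -(sqWeight z : ℂ)) hd.neg]
  congr 1
  have := dz_neg (f := fun z => (sqWeight z : ℂ)) (z := z)
  rw [dz_sqWeight] at this
  exact this

/-- `∂̄*_φ` is the formal adjoint of `∂̄` on test functions. -/
lemma inner_dbar_testToL2 (f g : testFunctions) :
    (inner ℂ (testToL2 sqWeight sqWeight_contDiff (dbarLin f))
      (testToL2 sqWeight sqWeight_contDiff g) : ℂ) =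
    inner ℂ (testToL2 sqWeight sqWeight_contDiff f)
      (testToL2 sqWeight sqWeight_contDiff (dbarStarLin sqWeight sqWeight_contDiff g)) := by
  rw [inner_testToL2, inner_testToL2]
  have hf : (fun z => conj (f.1 z)) ∈ testFunctions :=
    ⟨contDiff_conj.comp f.2.1, f.2.2.comp_left (map_zero _)⟩
  have hg : (fun z => cexp (-(sqWeight z : ℂ))) * g.1 ∈ testFunctions :=
    ⟨contDiff_gaussian.mul g.2.1, g.2.2.mul_left⟩
  have h := integral_mul_dz_test hf hg
  have e1 : ∀ z, cexp (-(sqWeight z : ℂ)) * (conj ((dbarLin f).1 z) * g.1 z) =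
      dz (fun z => conj (f.1 z)) z * ((fun z => cexp (-(sqWeight z : ℂ))) * g.1) z := fun z => by
    rw [dz_conj_comp (differentiable_of_mem f.2 z), Pi.mul_apply]
    change _ * (conj (dbar f.1 z) * _) = _
    ring
  have e2 : ∀ z, cexp (-(sqWeight z : ℂ)) *
      (conj (f.1 z) * (dbarStarLin sqWeight sqWeight_contDiff g).1 z) =
      -- Differentiating the Gaussian factor produces exactly the `z̄ g` term of the weighted
      -- adjoint, so the weighted identity reduces to unweighted integration by parts.
      -(conj (f.1 z) * dz ((fun z => cexp (-(sqWeight z : ℂ))) * g.1) z) := fun z => by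
    rw [dz_mul (contDiff_gaussian.differentiable (by simp) z) (differentiable_of_mem g.2 z),
      dz_gaussian]
    change _ * (_ * dbarStar sqWeight g.1 z) = _
    rw [dbarStar, dz_sqWeight]
    ring
  simp_rw [e1, e2]
  rw [integral_neg, h, neg_neg]

lemma inner_dbarStar_testToL2 (f g : testFunctions) :
    (inner ℂ (testToL2 sqWeight sqWeight_contDiff (dbarStarLin sqWeight sqWeight_contDiff f))
      (testToL2 sqWeight sqWeight_contDiff g) : ℂ) =
    inner ℂ (testToL2 sqWeight sqWeight_contDiff f)
      (testToL2 sqWeight sqWeight_contDiff (dbarLin g)) := by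
  rw [← inner_conj_symm, ← inner_dbar_testToL2, inner_conj_symm]

lemma mem_graph_onTest {φ : ℂ → ℝ} {hφ : ContDiff ℝ ∞ φ}
    {A : testFunctions →ₗ[ℂ] testFunctions} {x : L2 φ × L2 φ} :
    x ∈ (onTest φ hφ A).graph ↔ ∃ f, testToL2 φ hφ f = x.1 ∧ testToL2 φ hφ (A f) = x.2 := by
  have key : ∀ (f : testFunctions) (h : testToL2 φ hφ f ∈ (onTest φ hφ A).domain),
      onTest φ hφ A ⟨testToL2 φ hφ f, h⟩ = testToL2 φ hφ (A f) := by
    intro f h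
    change testToL2 φ hφ (A ((LinearEquiv.ofInjective (testToL2 φ hφ)
      (testToL2_injective φ hφ)).symm ⟨testToL2 φ hφ f, h⟩)) = _
    congr 2
    rw [LinearEquiv.symm_apply_eq]
    rfl
  rw [LinearPMap.mem_graph_iff]
  constructor
  · rintro ⟨⟨y, f, rfl⟩, h1, h2⟩
    exact ⟨f, h1, (key f _).symm.trans h2⟩
  · rintro ⟨f, h1, h2⟩
    exact ⟨⟨testToL2 φ hφ f, f, rfl⟩, h1, (key f _).trans h2⟩

lemma isFormalAdjoint_onTest_of_inner {φ : ℂ → ℝ} {hφ : ContDiff ℝ ∞ φ}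
    {A : testFunctions →ₗ[ℂ] testFunctions}
    (h : ∀ f g, (inner ℂ (testToL2 φ hφ (A f)) (testToL2 φ hφ g) : ℂ) =
      inner ℂ (testToL2 φ hφ f) (testToL2 φ hφ (A g))) :
    (onTest φ hφ A).IsFormalAdjoint (onTest φ hφ A) := by
  rw [isFormalAdjoint_self_iff_graph]
  intro p hp q hq
  obtain ⟨f, h1, h2⟩ := mem_graph_onTest.1 hp
  obtain ⟨g, h3, h4⟩ := mem_graph_onTest.1 hq
  rw [← h1, ← h2, ← h3, ← h4, h]

lemma dense_domain_onTest {φ : ℂ → ℝ} {hφ : ContDiff ℝ ∞ φ}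
    {A : testFunctions →ₗ[ℂ] testFunctions} : Dense ((onTest φ hφ A).domain : Set (L2 φ)) := by
  have := isLocallyFiniteMeasure_weightMeasure hφ
  refine (Lp.dense_hasCompactSupport_contDiff (F := ℂ) (μ := weightMeasure φ) (p := 2)
    ENNReal.ofNat_ne_top).mono ?_
  rintro f ⟨g, hfg, h1, h2⟩
  refine ⟨⟨g, h2, h1⟩, ?_⟩
  refine Lp.ext ?_
  exact (memLp_test hφ (f := g) ⟨h2, h1⟩).coeFn_toLp.trans hfg.symm

end GaussianSpace

/-! ### Cutoffs: polynomials belong to the domains of the closures. -/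

section Cutoff

open MeasureTheory Complex Filter Topology
open scoped ComplexConjugate

/-- A smooth bump function equal to `1` on the unit ball. -/
noncomputable def bump (z : ℂ) : ℂ :=
  ((⟨1, 2, one_pos, one_lt_two⟩ : ContDiffBump (0 : ℂ)) z : ℝ)

lemma bump_mem : bump ∈ testFunctions :=
  ⟨ofRealCLM.contDiff.comp (ContDiffBump.contDiff _),
    (ContDiffBump.hasCompactSupport _).comp_left ofReal_zero⟩

lemma bump_eq_one {z : ℂ} (hz : ‖z‖ ≤ 1) : bump z = 1 := by
  rw [bump, ContDiffBump.one_of_mem_closedBall _ (by simpa using hz), ofReal_one]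

/-- The smooth cutoff functions `z ↦ bump (z / (n + 1))`. -/
noncomputable def cutoff (n : ℕ) (z : ℂ) : ℂ := bump (((n : ℝ) + 1)⁻¹ • z)

lemma cutoff_mem (n : ℕ) : cutoff n ∈ testFunctions := by
  refine ⟨bump_mem.1.comp (contDiff_const_smul _), ?_⟩
  exact bump_mem.2.comp_homeomorph (Homeomorph.smulOfNeZero (((n : ℝ) + 1)⁻¹) (by positivity))

lemma cutoff_eventuallyEq_one (z : ℂ) : ∀ᶠ n in atTop, cutoff n =ᶠ[𝓝 z] 1 := by
  obtain ⟨N, hN⟩ := exists_nat_gt ‖z‖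
  filter_upwards [eventually_ge_atTop N] with n hn
  have h1 : ‖z‖ < n + 1 := hN.trans_le ((Nat.cast_le.2 hn).trans (by linarith))
  filter_upwards [continuous_norm.continuousAt.eventually_lt continuousAt_const h1] with w hw
  refine bump_eq_one ?_
  rw [norm_smul, norm_inv, Real.norm_of_nonneg (by positivity), inv_mul_le_iff₀ (by positivity)]
  linarith

lemma dz_cutoff (n : ℕ) (z : ℂ) :
    dz (cutoff n) z = (((n : ℝ) + 1)⁻¹ : ℝ) * dz bump (((n : ℝ) + 1)⁻¹ • z) :=
  dz_comp_real_smul _ (differentiable_of_mem bump_mem)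

lemma dbar_cutoff (n : ℕ) (z : ℂ) :
    dbar (cutoff n) z = (((n : ℝ) + 1)⁻¹ : ℝ) * dbar bump (((n : ℝ) + 1)⁻¹ • z) :=
  dbar_comp_real_smul _ (differentiable_of_mem bump_mem)

lemma dz_dbar_cutoff (n : ℕ) (z : ℂ) :
    dz (dbar (cutoff n)) z =
      (((n : ℝ) + 1)⁻¹ : ℝ) * ((((n : ℝ) + 1)⁻¹ : ℝ) * dz (dbar bump) (((n : ℝ) + 1)⁻¹ • z)) := by
  have hd := differentiable_of_mem (dbar_mem bump_mem)
  have e : dbar (cutoff n) =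
      ((((n : ℝ) + 1)⁻¹ : ℝ) : ℂ) • fun w => dbar bump (((n : ℝ) + 1)⁻¹ • w) :=
    funext fun w => dbar_cutoff n w
  have hd2 : DifferentiableAt ℝ (fun w => dbar bump (((n : ℝ) + 1)⁻¹ • w)) z :=
    (hd _).comp z (by fun_prop)
  rw [e, dz_const_smul _ hd2, dz_comp_real_smul _ hd]

lemma exists_norm_le_of_mem {f : ℂ → ℂ} (hf : f ∈ testFunctions) : ∃ C, ∀ z, ‖f z‖ ≤ C :=
  hf.2.exists_bound_of_continuous hf.1.continuous

/-- The cutoff functions and their derivatives up to order two are uniformly bounded. -/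
lemma exists_cutoff_bound : ∃ C, 0 ≤ C ∧ ∀ n z, ‖cutoff n z‖ ≤ C ∧ ‖dz (cutoff n) z‖ ≤ C ∧
    ‖dbar (cutoff n) z‖ ≤ C ∧ ‖dz (dbar (cutoff n)) z‖ ≤ C := by
  obtain ⟨C1, h1⟩ := exists_norm_le_of_mem bump_mem
  obtain ⟨C2, h2⟩ := exists_norm_le_of_mem (dz_mem bump_mem)
  obtain ⟨C3, h3⟩ := exists_norm_le_of_mem (dbar_mem bump_mem)
  obtain ⟨C4, h4⟩ := exists_norm_le_of_mem (dz_mem (dbar_mem bump_mem))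
  have p1 := (norm_nonneg _).trans (h1 0)
  have p2 := (norm_nonneg _).trans (h2 0)
  have p3 := (norm_nonneg _).trans (h3 0)
  have p4 := (norm_nonneg _).trans (h4 0)
  have hc : ∀ (n : ℕ) (w : ℂ), ‖((((n : ℝ) + 1)⁻¹ : ℝ) : ℂ) * w‖ ≤ ‖w‖ := by
    intro n w
    rw [norm_mul, norm_real, Real.norm_of_nonneg (by positivity)]
    exact mul_le_of_le_one_left (norm_nonneg _)
      (inv_le_one_of_one_le₀ (by linarith [n.cast_nonneg (α := ℝ)]))
  refine ⟨C1 + C2 + C3 + C4, by positivity, fun n z => ⟨(h1 _).trans (by linarith), ?_, ?_, ?_⟩⟩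
  · rw [dz_cutoff]
    exact (hc _ _).trans ((h2 _).trans (by linarith))
  · rw [dbar_cutoff]
    exact (hc _ _).trans ((h3 _).trans (by linarith))
  · rw [dz_dbar_cutoff]
    exact (hc _ _).trans ((hc _ _).trans ((h4 _).trans (by linarith)))

lemma cutoff_mul_mem (n : ℕ) {p : ℂ → ℂ} (hp : p ∈ polys) : cutoff n * p ∈ testFunctions :=
  ⟨(cutoff_mem n).1.mul (contDiff_of_mem_polys hp), (cutoff_mem n).2.mul_right⟩

lemma lap_mem {f : ℂ → ℂ} (hf : f ∈ testFunctions) : lap f ∈ testFunctions := by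
  have := dbarStar_mem sqWeight_contDiff (dbar_mem hf)
  convert this using 1
  exact funext fun z => (dbarStar_dbar f z).symm

/-- A majorant independent of `n` for dominated convergence. One factor `exp ‖z‖` absorbs the growth
of the polynomial, the other the coefficient `z̄` of `lap` when it falls on the cutoff. -/
lemma exists_lap_cutoff_mul_bound {p : ℂ → ℂ} (hp : p ∈ polys) :
    ∃ C, ∀ n z, ‖lap (cutoff n * p) z‖ ≤ C * Real.exp (2 * ‖z‖) ∧
      ‖(cutoff n * p) z‖ ≤ C * Real.exp (2 * ‖z‖) := by
  obtain ⟨C, hC, hcut⟩ := exists_cutoff_bound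
  obtain ⟨D1, hD1, h1⟩ := norm_le_exp_of_mem_polys hp
  obtain ⟨D2, hD2, h2⟩ := norm_le_exp_of_mem_polys (dz_mem_polys hp)
  obtain ⟨D3, hD3, h3⟩ := norm_le_exp_of_mem_polys (dbar_mem_polys hp)
  obtain ⟨D4, hD4, h4⟩ := norm_le_exp_of_mem_polys (lap_mem_polys hp)
  -- The summands match the four terms of `lap_mul`; `2 * D1` comes from `‖lap (cutoff n) z‖ ≤ 2 * C
  -- * exp ‖z‖`.
  refine ⟨C * (D4 + 2 * D1 + D2 + D3), fun n z => ?_⟩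
  obtain ⟨c1, c2, c3, c4⟩ := hcut n z
  have e0 := Real.add_one_le_exp ‖z‖
  have e1 : 1 ≤ Real.exp ‖z‖ := by linarith [norm_nonneg z]
  have e2 : Real.exp (2 * ‖z‖) = Real.exp ‖z‖ * Real.exp ‖z‖ := by
    rw [two_mul, Real.exp_add]
  set E := Real.exp ‖z‖
  have hL : ‖lap (cutoff n) z‖ ≤ 2 * C * E := by
    refine (norm_add_le _ _).trans ?_
    rw [norm_neg, norm_mul, RCLike.norm_conj]
    have : ‖z‖ * ‖dbar (cutoff n) z‖ ≤ E * C := by gcongr; linarith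
    nlinarith
  have k1 : ‖cutoff n z * lap p z‖ ≤ C * D4 * (E * E) := by
    rw [norm_mul]
    calc _ ≤ C * (D4 * E) := by gcongr; exact h4 z
      _ ≤ C * (D4 * (E * E)) := by gcongr; nlinarith
      _ = _ := by ring
  have k2 : ‖lap (cutoff n) z * p z‖ ≤ C * (2 * D1) * (E * E) := by
    rw [norm_mul]
    calc _ ≤ 2 * C * E * (D1 * E) := by gcongr; exact h1 z
      _ = _ := by ring
  have k3 : ‖dbar (cutoff n) z * dz p z‖ ≤ C * D2 * (E * E) := by
    rw [norm_mul]
    calc _ ≤ C * (D2 * E) := by gcongr; exact h2 z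
      _ ≤ C * (D2 * (E * E)) := by gcongr; nlinarith
      _ = _ := by ring
  have k4 : ‖dz (cutoff n) z * dbar p z‖ ≤ C * D3 * (E * E) := by
    rw [norm_mul]
    calc _ ≤ C * (D3 * E) := by gcongr; exact h3 z
      _ ≤ C * (D3 * (E * E)) := by gcongr; nlinarith
      _ = _ := by ring
  rw [e2]
  constructor
  · rw [lap_mul (cutoff_mem n).1 (contDiff_of_mem_polys hp)]
    refine (norm_sub_le _ _).trans ((add_le_add_left (norm_sub_le _ _) _).trans
      ((add_le_add_left (add_le_add_left (norm_add_le _ _) _) _).trans ?_))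
    nlinarith
  · rw [Pi.mul_apply, norm_mul]
    have : 0 ≤ C * (D4 + D1 + D2 + D3) * (E * E) := by positivity
    calc _ ≤ C * (D1 * E) := by gcongr; exact h1 z
      _ ≤ C * (D1 * (E * E)) := by gcongr; nlinarith
      _ ≤ _ := by nlinarith

/-- The class of a polynomial in the weighted `L²` space. -/
noncomputable def polyToL2 : polys →ₗ[ℂ] L2 sqWeight where
  toFun p := (memLp_of_mem_polys p.2).toLp p
  map_add' p q := MemLp.toLp_add (memLp_of_mem_polys p.2) (memLp_of_mem_polys q.2)
  map_smul' c p := MemLp.toLp_const_smul c (memLp_of_mem_polys p.2)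

lemma polyToL2_injective : Function.Injective polyToL2 := by
  intro f g h
  have := isOpenPosMeasure_weightMeasure sqWeight_contDiff
  have h' : (f : ℂ → ℂ) =ᵐ[weightMeasure sqWeight] g :=
    (MemLp.toLp_eq_toLp_iff (memLp_of_mem_polys f.2) (memLp_of_mem_polys g.2)).1 h
  exact Subtype.ext (Measure.eq_of_ae_eq h' (contDiff_of_mem_polys f.2).continuous
    (contDiff_of_mem_polys g.2).continuous)

lemma tendsto_cutoff_mul {p : ℂ → ℂ} (hp : p ∈ polys) :
    Tendsto (fun n => testToL2 sqWeight sqWeight_contDiff ⟨cutoff n * p, cutoff_mul_mem n hp⟩)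
      atTop (𝓝 (polyToL2 ⟨p, hp⟩)) := by
  obtain ⟨C, hC⟩ := exists_lap_cutoff_mul_bound hp
  refine tendsto_toLp_of_dominated (fun n => memLp_test sqWeight_contDiff (cutoff_mul_mem n hp))
    (memLp_of_mem_polys hp) ((memLp_exp_norm 2).const_mul C) (fun n z => (hC n z).2) fun z => ?_
  refine tendsto_const_nhds.congr' ?_
  filter_upwards [cutoff_eventuallyEq_one z] with n hn
  simp [hn.eq_of_nhds]

lemma tendsto_lap_cutoff_mul {p : ℂ → ℂ} (hp : p ∈ polys) :
    Tendsto (fun n => testToL2 sqWeight sqWeight_contDiff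
      ⟨lap (cutoff n * p), lap_mem (cutoff_mul_mem n hp)⟩)
      atTop (𝓝 (polyToL2 ⟨lap p, lap_mem_polys hp⟩)) := by
  obtain ⟨C, hC⟩ := exists_lap_cutoff_mul_bound hp
  refine tendsto_toLp_of_dominated
    (fun n => memLp_test sqWeight_contDiff (lap_mem (cutoff_mul_mem n hp)))
    (memLp_of_mem_polys (lap_mem_polys hp)) ((memLp_exp_norm 2).const_mul C)
    (fun n z => (hC n z).1) fun z => ?_
  refine tendsto_const_nhds.congr' ?_
  -- For large `n` the cutoff is `1` on a whole neighbourhood of `z`, so the derivatives agree there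
  -- as well.
  filter_upwards [cutoff_eventuallyEq_one z] with n hn
  have h1 : cutoff n * p =ᶠ[𝓝 z] p := by
    filter_upwards [hn] with w hw
    simp [hw]
  have h2 : dbar (cutoff n * p) =ᶠ[𝓝 z] dbar p := h1.eventuallyEq_nhds.mono fun w => dbar_congr
  simp only [lap, dz_congr h2, h2.eq_of_nhds]

/-- Polynomials lie in the domain of the closure of an operator that acts on test functions as
`lap + c`, and the closure acts on them in the same way. -/
lemma polyToL2_mem_graph_closure {B : testFunctions →ₗ[ℂ] testFunctions} {c : ℂ}
    (hB : ∀ f : testFunctions, ∀ z, (B f : ℂ → ℂ) z = lap f z + c * f.1 z)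
    (hc : (onTest sqWeight sqWeight_contDiff B).IsClosable) (p : polys) :
    (polyToL2 p, polyToL2 ⟨lap p, lap_mem_polys p.2⟩ + c • polyToL2 p) ∈
      (onTest sqWeight sqWeight_contDiff B).closure.graph := by
  rw [← hc.graph_closure_eq_closure_graph]
  have h := (tendsto_cutoff_mul p.2).prodMk_nhds
    ((tendsto_lap_cutoff_mul p.2).add ((tendsto_cutoff_mul p.2).const_smul c))
  refine mem_closure_of_tendsto h (Eventually.of_forall fun n => ?_)
  refine mem_graph_onTest.2 ⟨⟨cutoff n * p.1, cutoff_mul_mem n p.2⟩, rfl, ?_⟩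
  rw [← map_smul, ← map_add]
  congr 1
  ext z
  rw [hB]
  rfl

end Cutoff

/-! ### Complex Hermite polynomials. -/

section Hermite

open Complex
open scoped ComplexConjugate Nat

/-- `lap` as a linear map on polynomials. -/
noncomputable def lapPoly : polys →ₗ[ℂ] polys where
  toFun p := ⟨lap p, lap_mem_polys p.2⟩
  map_add' p q := by
    ext z
    have hp := differentiable_of_mem_polys p.2
    have hq := differentiable_of_mem_polys q.2
    have hp' := differentiable_of_mem_polys (dbar_mem_polys p.2)
    have hq' := differentiable_of_mem_polys (dbar_mem_polys q.2)
    have e : dbar (p.1 + q.1) = dbar p.1 + dbar q.1 := funext fun w => dbar_add (hp w) (hq w)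
    simp only [Submodule.coe_add, Pi.add_apply, lap, e, dz_add (hp' z) (hq' z)]
    ring
  map_smul' c p := by
    ext z
    have hp := differentiable_of_mem_polys p.2
    have hp' := differentiable_of_mem_polys (dbar_mem_polys p.2)
    have e : dbar (c • p.1) = c • dbar p.1 := funext fun w => dbar_const_smul c (hp w)
    simp only [Submodule.coe_smul, Pi.smul_apply, lap, e, dz_const_smul c (hp' z),
      RingHom.id_apply, smul_eq_mul]
    ring

/-- `∂̄` as a linear map on polynomials. -/
noncomputable def dbarPoly : polys →ₗ[ℂ] polys where
  toFun p := ⟨dbar p, dbar_mem_polys p.2⟩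
  map_add' p q := Subtype.ext (funext fun z =>
    dbar_add (differentiable_of_mem_polys p.2 z) (differentiable_of_mem_polys q.2 z))
  map_smul' c p := Subtype.ext (funext fun z =>
    dbar_const_smul c (differentiable_of_mem_polys p.2 z))

/-- The monomial `z̄^a z^b` as an element of `polys`. -/
noncomputable def monPoly (a b : ℕ) : polys := ⟨mon a b, mon_mem_polys a b⟩

lemma dbarPoly_mon (a b : ℕ) : dbarPoly (monPoly a b) = (a : ℂ) • monPoly (a - 1) b :=
  Subtype.ext (dbar_mon a b)

lemma lapPoly_mon (a b : ℕ) : lapPoly (monPoly a b) =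
    (a : ℂ) • monPoly a b - ((a : ℂ) * b) • monPoly (a - 1) (b - 1) := by
  ext z
  change lap (mon a b) z = _
  have h : Differentiable ℝ (mon (a - 1) b) := (contDiff_mon _ _).differentiable (by simp)
  rw [lap, dbar_mon, dz_const_smul _ (h z), dz_mon]
  simp only [monPoly, Submodule.coe_sub, Submodule.coe_smul, Pi.sub_apply, Pi.smul_apply,
    smul_eq_mul, mon]
  rcases a with _ | a
  · simp
  · simp only [Nat.add_sub_cancel]
    ring

/-- The coefficients of the complex Hermite polynomials. -/
noncomputable def hermCoeff (a b j : ℕ) : ℂ :=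
  (-1) ^ j * (j ! : ℂ) * (a.choose j : ℂ) * (b.choose j : ℂ)

/-- The complex Hermite polynomial with leading monomial `z̄^a z^b`. -/
noncomputable def herm (a b : ℕ) : polys :=
  ∑ j ∈ Finset.range (a + 1), hermCoeff a b j • monPoly (a - j) (b - j)

/-- The two-term recursion that makes `lap` telescope on `herm a b`. -/
lemma hermCoeff_succ (a b j : ℕ) :
    hermCoeff a b j * ((a - j : ℕ) * (b - j : ℕ)) = -((j + 1 : ℕ) * hermCoeff a b (j + 1)) := by
  have h1 : (a.choose (j + 1) : ℂ) * (j + 1) = a.choose j * (a - j : ℕ) := by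
    exact_mod_cast Nat.choose_succ_right_eq a j
  have h2 : (b.choose (j + 1) : ℂ) * (j + 1) = b.choose j * (b - j : ℕ) := by
    exact_mod_cast Nat.choose_succ_right_eq b j
  simp only [hermCoeff, Nat.factorial_succ]
  push_cast
  linear_combination (-(-1) ^ j * (j ! : ℂ) * (b.choose j * (b - j : ℕ))) * h1 -
    ((-1) ^ j * (j ! : ℂ) * (a.choose (j + 1) * (j + 1))) * h2

lemma lapPoly_herm (a b : ℕ) : lapPoly (herm a b) = (a : ℂ) • herm a b := by
  -- By the recursion, `lap` sends the `j`-th term `t_j` to `a t_j - g j + g (j + 1)`, and the `g`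
  -- parts cancel in the sum.
  set g : ℕ → polys := fun j => ((j : ℂ) * hermCoeff a b j) • monPoly (a - j) (b - j) with hg
  -- Both ends vanish: `g 0` has the factor `0`, and `g (a + 1)` contains `a.choose (a + 1) = 0`.
  have hsum : ∑ j ∈ Finset.range (a + 1), g (j + 1) = ∑ j ∈ Finset.range (a + 1), g j := by
    have h1 := Finset.sum_range_succ' g (a + 1)
    rw [Finset.sum_range_succ g (a + 1)] at h1
    simpa [hg, hermCoeff] using h1.symm
  have hterm : ∀ j ∈ Finset.range (a + 1),
      lapPoly (hermCoeff a b j • monPoly (a - j) (b - j)) =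
      ((a : ℂ) • (hermCoeff a b j • monPoly (a - j) (b - j)) - g j) + g (j + 1) := by
    intro j hj
    have hj' : j ≤ a := Nat.lt_succ_iff.1 (Finset.mem_range.1 hj)
    rw [map_smul, lapPoly_mon, smul_sub, smul_smul, smul_smul, hermCoeff_succ, smul_smul, hg,
      Nat.sub_sub, Nat.sub_sub, neg_smul, sub_neg_eq_add, ← sub_smul, Nat.cast_sub hj']
    congr 2
    ring
  rw [herm, map_sum, Finset.sum_congr rfl hterm, Finset.sum_add_distrib, Finset.sum_sub_distrib,
    hsum, sub_add_cancel, Finset.smul_sum]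

lemma dbarPoly_herm (a b : ℕ) : dbarPoly (herm (a + 1) b) = ((a + 1 : ℕ) : ℂ) • herm a b := by
  rw [herm, map_sum, Finset.sum_range_succ, herm, Finset.smul_sum]
  -- The last term contains no `z̄`, so `∂̄` kills it and the two sums have equal length.
  have h0 : dbarPoly (hermCoeff (a + 1) b (a + 1) •
      monPoly (a + 1 - (a + 1)) (b - (a + 1))) = 0 := by
    rw [map_smul, dbarPoly_mon]
    simp
  rw [h0, add_zero]
  refine Finset.sum_congr rfl fun j hj => ?_
  have h1 : (a.choose j : ℂ) * (a + 1) = (a + 1).choose j * (a + 1 - j : ℕ) := by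
    exact_mod_cast Nat.choose_mul_succ_eq a j
  rw [map_smul, dbarPoly_mon, smul_smul, smul_smul, show a + 1 - j - 1 = a - j by omega]
  congr 1
  simp only [hermCoeff]
  push_cast
  linear_combination (-(-1) ^ j * (j ! : ℂ) * (b.choose j : ℂ)) * h1

/-- Since `∂̄` lowers the first index up to a nonzero factor, everything reduces to `herm 0 b`,
which is `z^b` and takes the value `1` at `1`. -/
lemma herm_ne_zero (a b : ℕ) : herm a b ≠ 0 := by
  induction a with
  | zero =>
    intro h
    have h1 : (herm 0 b).1 1 = 0 := by
      rw [h]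
      rfl
    simp [herm, hermCoeff, monPoly, mon] at h1
  | succ a ih =>
    intro h
    have h1 := dbarPoly_herm a b
    rw [h, map_zero, eq_comm, smul_eq_zero] at h1
    refine ih (h1.resolve_left ?_)
    exact_mod_cast Nat.succ_ne_zero a

/-- The passage from monomials to Hermite polynomials is unitriangular: the correction terms have
smaller first exponent. -/
lemma monPoly_mem_span_herm (a b : ℕ) :
    monPoly a b ∈ Submodule.span ℂ (Set.range fun p : ℕ × ℕ => herm p.1 p.2) := by
  induction a using Nat.strong_induction_on generalizing b with
  | _ a ih =>
    have h : monPoly a b = herm a b -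
        ∑ j ∈ Finset.range a, hermCoeff a b (j + 1) • monPoly (a - (j + 1)) (b - (j + 1)) := by
      rw [herm, Finset.sum_range_succ']
      simp [hermCoeff]
    rw [h]
    refine Submodule.sub_mem _ (Submodule.subset_span ⟨(a, b), rfl⟩)
      (Submodule.sum_mem _ fun j hj => Submodule.smul_mem _ _ (ih _ ?_ _))
    have := Finset.mem_range.1 hj
    omega

lemma span_herm : Submodule.span ℂ (Set.range fun p : ℕ × ℕ => herm p.1 p.2) = ⊤ := by
  rw [eq_top_iff]
  rintro ⟨p, hp⟩ -
  induction hp using Submodule.span_induction with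
  | mem x h =>
    obtain ⟨⟨a, b⟩, rfl⟩ := h
    exact monPoly_mem_span_herm a b
  | zero => exact Submodule.zero_mem _
  | add x y hx' hy' hx hy => exact Submodule.add_mem _ hx hy
  | smul c x hx' hx => exact Submodule.smul_mem _ c hx

/-- The complex Hermite polynomials with a fixed first index are eigenvectors of the rotation by
one radian for distinct eigenvalues, hence linearly independent. -/
lemma linearIndependent_herm (a : ℕ) : LinearIndependent ℂ fun b => (herm a b).1 := by
  let R : Module.End ℂ (ℂ → ℂ) :=
    { toFun := fun f z => f (cexp I * z)
      map_add' := fun _ _ => rfl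
      map_smul' := fun _ _ => rfl }
  refine Module.End.eigenvectors_linearIndependent' R (fun b : ℕ => cexp (((b : ℂ) - a) * I)) ?_ _
    fun b => ⟨?_, fun h => herm_ne_zero a b (Subtype.ext h)⟩
  · intro b c hbc
    rw [exp_eq_exp_iff_exists_int] at hbc
    obtain ⟨n, hn⟩ := hbc
    have h1 : ((b : ℂ) - a) = (c - a) + n * (2 * Real.pi) := by
      refine mul_right_cancel₀ I_ne_zero ?_
      rw [hn]
      ring
    have h2 : ((b : ℝ) - a) = (c - a) + n * (2 * Real.pi) := by exact_mod_cast h1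
    by_contra hne
    have hn0 : n ≠ 0 := by
      rintro rfl
      refine hne ?_
      have : (b : ℝ) = c := by
        rw [Int.cast_zero] at h2
        linarith
      exact_mod_cast this
    -- Equal eigenvalues for `b ≠ c` would give `π = (b - c) / (2n)` with an integer `n ≠ 0`.
    refine irrational_pi.ne_rat (((b : ℚ) - c) / (2 * n)) ?_
    push_cast
    rw [eq_div_iff (by simpa using hn0)]
    linarith
  · rw [Module.End.mem_eigenspace_iff]
    ext z
    change (herm a b).1 (cexp I * z) = cexp (((b : ℂ) - a) * I) * (herm a b).1 z
    have hconj : conj (cexp I) = cexp (-I) := by rw [← exp_conj, conj_I]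
    simp only [herm, Submodule.coe_sum, Submodule.coe_smul, Finset.sum_apply, Pi.smul_apply,
      smul_eq_mul, monPoly, mon, Finset.mul_sum]
    refine Finset.sum_congr rfl fun j hj => ?_
    -- Every genuine term has weight `b - a`. For `j > b` the truncated exponent would break this,
    -- but the coefficient is then zero.
    by_cases hjb : j ≤ b
    · have hja : j ≤ a := Nat.lt_succ_iff.1 (Finset.mem_range.1 hj)
      have h : cexp (-I) ^ (a - j) * cexp I ^ (b - j) = cexp (((b : ℂ) - a) * I) := by
        rw [← exp_nat_mul, ← exp_nat_mul, ← exp_add, Nat.cast_sub hja, Nat.cast_sub hjb]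
        congr 1
        ring
      rw [map_mul, hconj, mul_pow, mul_pow, ← h]
      ring
    · simp [hermCoeff, Nat.choose_eq_zero_of_lt (not_le.1 hjb)]

lemma hermCoeff_eq {a b j : ℕ} (ha : j ≤ a) (hb : j ≤ b) : hermCoeff a b j =
    ((-1) ^ j * (a ! : ℂ) * (b ! : ℂ)) / ((j ! : ℂ) * ((a - j)! : ℂ) * ((b - j)! : ℂ)) := by
  rw [hermCoeff, Nat.cast_choose ℂ ha, Nat.cast_choose ℂ hb]
  have h1 : (j ! : ℂ) ≠ 0 := by exact_mod_cast j.factorial_ne_zero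
  have h2 : ((a - j)! : ℂ) ≠ 0 := by exact_mod_cast (a - j).factorial_ne_zero
  have h3 : ((b - j)! : ℂ) ≠ 0 := by exact_mod_cast (b - j).factorial_ne_zero
  field_simp

/-- The hypotheses force `N = min a b`: beyond it a binomial factor vanishes. `N = m` serves
`u_{k,m}`, and `N = k` serves `v_{k,m}`. -/
lemma herm_apply {a b N : ℕ} (ha : N ≤ a) (hb : N ≤ b) (hN : a ≤ N ∨ b ≤ N) (z : ℂ) :
    (herm a b).1 z = conj z ^ a * z ^ b + ∑ j ∈ Finset.Icc 1 N,
      ((-1) ^ j * (a ! : ℂ) * (b ! : ℂ)) / ((j ! : ℂ) * ((a - j)! : ℂ) * ((b - j)! : ℂ)) *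
        conj z ^ (a - j) * z ^ (b - j) := by
  have h1 : (herm a b).1 z =
      ∑ j ∈ Finset.range (a + 1), hermCoeff a b j * (conj z ^ (a - j) * z ^ (b - j)) := by
    simp only [herm, Submodule.coe_sum, Submodule.coe_smul, Finset.sum_apply, Pi.smul_apply,
      smul_eq_mul, monPoly, mon]
  have h2 : ∑ j ∈ Finset.range (N + 1), hermCoeff a b j * (conj z ^ (a - j) * z ^ (b - j)) =
      ∑ j ∈ Finset.range (a + 1), hermCoeff a b j * (conj z ^ (a - j) * z ^ (b - j)) := by
    refine Finset.sum_subset (Finset.range_mono (by omega)) fun j hj hj' => ?_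
    simp only [Finset.mem_range] at hj hj'
    simp [hermCoeff, Nat.choose_eq_zero_of_lt (show b < j by omega)]
  rw [h1, ← h2, Finset.range_eq_Ico, Finset.sum_eq_sum_Ico_succ_bot (Nat.succ_pos N)]
  congr 1
  · simp [hermCoeff]
  · refine Finset.sum_congr (by ext j; simp) fun j hj => ?_
    have := Finset.mem_Icc.1 hj
    rw [hermCoeff_eq (by omega) (by omega)]
    ring

lemma uPoly_eq_herm (k m : ℕ) : uPoly k m = (herm (k + m) m).1 :=
  funext fun z => (herm_apply (by omega) le_rfl (Or.inr le_rfl) z).symm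

lemma vPoly_eq_herm (k m : ℕ) : vPoly k m = (herm k (k + m)).1 := by
  ext z
  rw [herm_apply le_rfl (by omega) (Or.inl le_rfl) z, vPoly]
  congr 1
  refine Finset.sum_congr rfl fun j _ => ?_
  ring

end Hermite

/-! ### Density of polynomials in the Gaussian `L²` space. -/

section Density

open MeasureTheory Complex Filter Topology
open scoped ComplexConjugate

/-- Uniqueness of the Fourier transform of a real integrable density. -/
lemma ae_eq_zero_of_integral_cexp_inner_eq_zero {μ : Measure ℂ} {g : ℂ → ℝ}
    (hg : Integrable g μ) (h : ∀ t : ℂ, ∫ x, (g x : ℂ) * cexp ((inner ℝ x t : ℝ) * I) ∂μ = 0) :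
    g =ᵐ[μ] 0 := by
  have hfin1 := isFiniteMeasure_withDensity_ofReal hg.2
  have hfin2 := isFiniteMeasure_withDensity_ofReal hg.neg.2
  have m1 : AEMeasurable (fun x => ENNReal.ofReal (g x)) μ := hg.1.aemeasurable.ennreal_ofReal
  have m2 : AEMeasurable (fun x => ENNReal.ofReal ((-g) x)) μ :=
    hg.neg.1.aemeasurable.ennreal_ofReal
  have hchar : ∀ k : ℂ → ℝ, AEMeasurable (fun x => ENNReal.ofReal (k x)) μ → ∀ t,
      charFun (μ.withDensity fun x => ENNReal.ofReal (k x)) t =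
        ∫ x, ((max (k x) 0 : ℝ) : ℂ) * cexp ((inner ℝ x t : ℝ) * I) ∂μ := by
    intro k hk t
    rw [charFun_apply, integral_withDensity_eq_integral_toReal_smul₀ hk
      (Eventually.of_forall fun z => ENNReal.ofReal_lt_top)]
    simp only [ENNReal.toReal_ofReal', real_smul]
  have hint : ∀ k : ℂ → ℝ, Integrable k μ → ∀ t : ℂ,
      Integrable (fun x => ((max (k x) 0 : ℝ) : ℂ) * cexp ((inner ℝ x t : ℝ) * I)) μ := by
    intro k hk t
    refine hk.pos_part.ofReal.mul_bdd (c := 1) ?_ (Eventually.of_forall fun x => ?_)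
    · have : Continuous fun x : ℂ => cexp ((inner ℝ x t : ℝ) * I) := by fun_prop
      exact this.aestronglyMeasurable
    · rw [norm_exp_ofReal_mul_I]
  -- The positive and negative parts of `g` define finite measures whose characteristic functions
  -- differ by the integral in `h`, which is zero.
  have heq : (μ.withDensity fun x => ENNReal.ofReal (g x)) =
      μ.withDensity fun x => ENNReal.ofReal ((-g) x) := by
    refine Measure.ext_of_charFun (funext fun t => ?_)
    rw [hchar _ m1, hchar _ m2, ← sub_eq_zero, ← integral_sub (hint _ hg t) (hint _ hg.neg t), ← h t]
    refine integral_congr_ae (Eventually.of_forall fun x => ?_)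
    simp only [Pi.neg_apply]
    rw [← sub_mul, ← ofReal_sub]
    congr 2
    rcases le_total (g x) 0 with hx | hx
    · rw [max_eq_right hx, max_eq_left (by linarith)]
      ring
    · rw [max_eq_left hx, max_eq_right (by linarith)]
      ring
  have hae := (withDensity_eq_iff m1 m2 hg.lintegral_lt_top.ne).1 heq
  filter_upwards [hae] with x hx
  simp only [Pi.neg_apply, Pi.zero_apply] at hx ⊢
  rcases lt_trichotomy (g x) 0 with h1 | h1 | h1
  · rw [ENNReal.ofReal_of_nonpos h1.le, eq_comm, ENNReal.ofReal_eq_zero] at hx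
    linarith
  · exact h1
  · rw [ENNReal.ofReal_of_nonpos (by linarith : -g x ≤ 0), ENNReal.ofReal_eq_zero] at hx
    linarith

lemma inner_mul_I_pow_mem_polys (t : ℂ) (n : ℕ) :
    (fun x : ℂ => (((inner ℝ x t : ℝ) : ℂ) * I) ^ n) ∈ polys := by
  induction n with
  | zero =>
    convert mon_mem_polys 0 0 using 1
    ext x
    simp [mon]
  | succ n ih =>
    convert polys.add_mem (polys.smul_mem (t / 2 * I) (mon_mul_mem_polys 1 0 ih))
      (polys.smul_mem (conj t / 2 * I) (mon_mul_mem_polys 0 1 ih)) using 1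
    ext x
    have : ((inner ℝ x t : ℝ) : ℂ) = (t * conj x + conj t * x) / 2 := by
      rw [Complex.inner, re_eq_add_conj]
      simp
    rw [pow_succ, mul_comm]
    nth_rw 1 [this]
    simp [mon]
    ring

/-- A function orthogonal to all polynomials has vanishing Fourier transform. -/
lemma integral_mul_cexp_inner_eq_zero {f : ℂ → ℂ} (hf : MemLp f 2 (weightMeasure sqWeight))
    (h : ∀ p ∈ polys, ∫ x, f x * p x ∂weightMeasure sqWeight = 0) (t : ℂ) :
    ∫ x, f x * cexp ((inner ℝ x t : ℝ) * I) ∂weightMeasure sqWeight = 0 := by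
  -- Partial sums of the exponential series of `i⟨x, t⟩`: polynomials in `x`, bounded by `exp (‖t‖
  -- ‖x‖)`, which lies in `L²`.
  set S : ℕ → ℂ → ℂ := fun N x =>
    ∑ n ∈ Finset.range N, (((inner ℝ x t : ℝ) : ℂ) * I) ^ n / (n.factorial : ℂ) with hS
  have hSp : ∀ N, S N ∈ polys := by
    intro N
    convert polys.sum_mem fun n (_ : n ∈ Finset.range N) =>
      polys.smul_mem ((n.factorial : ℂ)⁻¹) (inner_mul_I_pow_mem_polys t n) using 1
    ext x
    simp [hS, div_eq_inv_mul]
  have hb : ∀ N x, ‖S N x‖ ≤ Real.exp (‖t‖ * ‖x‖) := by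
    intro N x
    refine (norm_sum_le _ _).trans ?_
    refine (Finset.sum_le_sum fun n _ => ?_).trans
      (Real.sum_le_exp_of_nonneg (by positivity : 0 ≤ ‖t‖ * ‖x‖) N)
    rw [norm_div, norm_pow, norm_mul, norm_I, mul_one, norm_real, norm_natCast]
    gcongr
    rw [mul_comm]
    exact norm_inner_le_norm x t
  have hlim : Tendsto (fun N => ∫ x, f x * S N x ∂weightMeasure sqWeight) atTop
      (𝓝 (∫ x, f x * cexp ((inner ℝ x t : ℝ) * I) ∂weightMeasure sqWeight)) := by
    refine tendsto_integral_of_dominated_convergence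
      (fun x => ‖f x‖ * Real.exp (‖t‖ * ‖x‖)) (fun N => ?_) ?_ (fun N => ?_) ?_
    · exact hf.1.mul (contDiff_of_mem_polys (hSp N)).continuous.aestronglyMeasurable
    · exact hf.norm.integrable_mul (memLp_exp_norm ‖t‖)
    · refine Eventually.of_forall fun x => ?_
      rw [norm_mul]
      exact mul_le_mul_of_nonneg_left (hb N x) (norm_nonneg _)
    · refine Eventually.of_forall fun x => Tendsto.const_mul _ ?_
      rw [exp_eq_exp_ℂ]
      exact (NormedSpace.expSeries_div_hasSum_exp (((inner ℝ x t : ℝ) : ℂ) * I)).tendsto_sum_nat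
  exact tendsto_nhds_unique hlim (by simp [h _ (hSp _)])

lemma conj_mem_polys {p : ℂ → ℂ} (hp : p ∈ polys) : (fun z => conj (p z)) ∈ polys := by
  induction hp using Submodule.span_induction with
  | mem x h =>
    obtain ⟨⟨a, b⟩, rfl⟩ := h
    convert mon_mem_polys b a using 1
    ext z
    simp [mon]
    ring
  | zero =>
    convert polys.zero_mem using 1
    ext z
    simp
  | add x y _ _ hx hy =>
    convert polys.add_mem hx hy using 1
    ext z
    simp
  | smul c x _ hx =>
    convert polys.smul_mem (conj c) hx using 1
    ext z
    simp

/-- Polynomials are dense in the Gaussian `L²` space. -/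
lemma polyToL2_range_topologicalClosure :
    (LinearMap.range polyToL2).topologicalClosure = ⊤ := by
  rw [Submodule.topologicalClosure_eq_top_iff, Submodule.eq_bot_iff]
  intro f hf
  have hfL : MemLp f 2 (weightMeasure sqWeight) := Lp.memLp f
  have h1 : ∀ p ∈ polys, ∫ x, f x * p x ∂weightMeasure sqWeight = 0 := by
    intro p hp
    have := hf _ ⟨⟨_, conj_mem_polys hp⟩, rfl⟩
    rw [L2.inner_def] at this
    rw [← this]
    refine integral_congr_ae ?_
    filter_upwards [(memLp_of_mem_polys (conj_mem_polys hp)).coeFn_toLp] with z hz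
    change _ = inner ℂ (((memLp_of_mem_polys (conj_mem_polys hp)).toLp _) z) _
    rw [hz, RCLike.inner_apply, conj_conj]
  -- Because polynomials are stable under conjugation, `conj f` also annihilates them. Hence so do
  -- the real and imaginary parts of `f`, to which the real uniqueness statement applies.
  have h2 : ∀ p ∈ polys, ∫ x, conj (f x) * p x ∂weightMeasure sqWeight = 0 := by
    intro p hp
    have := congrArg conj (h1 _ (conj_mem_polys hp))
    rw [← integral_conj, map_zero] at this
    simpa using this
  have hi1 : ∀ p ∈ polys, Integrable (fun x => f x * p x) (weightMeasure sqWeight) := fun p hp =>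
    hfL.integrable_mul (memLp_of_mem_polys hp)
  have hi2 : ∀ p ∈ polys, Integrable (fun x => conj (f x) * p x) (weightMeasure sqWeight) :=
    fun p hp => hfL.star.integrable_mul (memLp_of_mem_polys hp)
  have hone : MemLp (fun _ => (1 : ℂ)) 2 (weightMeasure sqWeight) := by
    convert memLp_of_mem_polys (mon_mem_polys 0 0) using 1
    ext z
    simp [mon]
  have hint : Integrable f (weightMeasure sqWeight) := by
    have := hfL.integrable_mul hone
    refine this.congr (Eventually.of_forall fun z => ?_)
    simp
  have hre : (fun x => (f x).re) =ᵐ[weightMeasure sqWeight] 0 := by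
    refine ae_eq_zero_of_integral_cexp_inner_eq_zero hint.re
      (integral_mul_cexp_inner_eq_zero hfL.re.ofReal fun p hp => ?_)
    have e : ∀ x, ((f x).re : ℂ) * p x = (1 / 2) * (f x * p x + conj (f x) * p x) := fun x => by
      rw [re_eq_add_conj]
      ring
    change ∫ x, ((f x).re : ℂ) * p x ∂weightMeasure sqWeight = 0
    simp_rw [e]
    rw [integral_const_mul, integral_add (hi1 p hp) (hi2 p hp), h1 p hp, h2 p hp]
    simp
  have him : (fun x => (f x).im) =ᵐ[weightMeasure sqWeight] 0 := by
    refine ae_eq_zero_of_integral_cexp_inner_eq_zero hint.im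
      (integral_mul_cexp_inner_eq_zero hfL.im.ofReal fun p hp => ?_)
    have e : ∀ x, ((f x).im : ℂ) * p x = (1 / (2 * I)) * (f x * p x - conj (f x) * p x) :=
      fun x => by
        rw [im_eq_sub_conj]
        ring
    change ∫ x, ((f x).im : ℂ) * p x ∂weightMeasure sqWeight = 0
    simp_rw [e]
    rw [integral_const_mul, integral_sub (hi1 p hp) (hi2 p hp), h1 p hp, h2 p hp]
    simp
  refine Lp.ext ?_
  filter_upwards [hre, him, Lp.coeFn_zero ℂ 2 (weightMeasure sqWeight)] with x a b c
  rw [c]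
  exact Complex.ext a b

lemma span_polyToL2_herm_topologicalClosure :
    (Submodule.span ℂ (Set.range fun p : ℕ × ℕ => polyToL2 (herm p.1 p.2))).topologicalClosure =
      ⊤ := by
  rw [← polyToL2_range_topologicalClosure, LinearMap.range_eq_map, ← span_herm,
    Submodule.map_span, ← Set.range_comp]
  rfl

end Density

/-! ### Spectra and eigenspaces of the two Laplacians. -/

section Spectrum

open MeasureTheory Complex Filter Topology

/-- The shifted naturals form a closed set, so a point outside has positive distance from it; this
is the gap that bounds the resolvent. -/
lemma exists_separation_nat_add (c : ℕ) (μ : ℂ)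
    (h : ∀ n : ℕ, μ ≠ (((n : ℝ) + c : ℝ) : ℂ)) :
    ∃ δ > 0, ∀ n : ℕ, δ ≤ ‖((((n : ℝ) + c : ℝ)) : ℂ) - μ‖ := by
  have hc : IsClosed (Set.range fun n : ℕ => (((n : ℝ) + c : ℝ) : ℂ)) :=
    (isometry_ofReal.isClosedEmbedding.comp
      ((Homeomorph.addRight (c : ℝ)).isClosedEmbedding.comp
        Nat.isClosedEmbedding_coe_real)).isClosed_range
  have hμ : μ ∉ Set.range fun n : ℕ => (((n : ℝ) + c : ℝ) : ℂ) := by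
    rintro ⟨n, hn⟩
    exact h n hn.symm
  refine ⟨_, (hc.notMem_iff_infDist_pos ⟨_, 0, rfl⟩).1 hμ, fun n => ?_⟩
  rw [← dist_eq_norm, dist_comm]
  exact Metric.infDist_le_dist_of_mem ⟨n, rfl⟩

/-- The spectral description of the closure of a symmetric operator that acts on test functions as
`lap + c`. -/
lemma spectral_description_of_lap_add {B : testFunctions →ₗ[ℂ] testFunctions} {c : ℕ}
    (hB : ∀ f : testFunctions, ∀ z, (B f : ℂ → ℂ) z = lap f z + c * f.1 z)
    (hsymm : ∀ f g, (inner ℂ (testToL2 sqWeight sqWeight_contDiff (B f))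
        (testToL2 sqWeight sqWeight_contDiff g) : ℂ) =
      inner ℂ (testToL2 sqWeight sqWeight_contDiff f)
        (testToL2 sqWeight sqWeight_contDiff (B g))) :
    IsSelfAdjoint (onTest sqWeight sqWeight_contDiff B).closure ∧
    spec (onTest sqWeight sqWeight_contDiff B).closure = {μ : ℂ | ∃ n : ℕ, μ = (n + c : ℕ)} ∧
    ∀ n : ℕ, eigenspace (onTest sqWeight sqWeight_contDiff B).closure ((n + c : ℕ) : ℂ) =
      closedSpan fun b => polyToL2 (herm n b) := by
  have hs := isFormalAdjoint_onTest_of_inner hsymm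
  have hd := dense_domain_onTest (hφ := sqWeight_contDiff) (A := B)
  have hc := isClosable_of_isFormalAdjoint_self hd hs
  have hcast : ∀ n : ℕ, (((n : ℝ) + c : ℝ) : ℂ) = ((n + c : ℕ) : ℂ) := fun n => by push_cast; rfl
  have he : ∀ n b : ℕ, polyToL2 (herm n b) ∈
      eigenspace (onTest sqWeight sqWeight_contDiff B).closure (((n : ℝ) + c : ℝ) : ℂ) := by
    intro n b
    rw [mem_eigenspace_iff_graph]
    have h1 := polyToL2_mem_graph_closure hB hc (herm n b)
    have h2 : (⟨lap (herm n b), lap_mem_polys (herm n b).2⟩ : polys) = (n : ℂ) • herm n b :=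
      lapPoly_herm n b
    rw [h2, map_smul, ← add_smul] at h1
    simpa using h1
  have hne : ∀ n, ∃ b, polyToL2 (herm n b) ≠ 0 := fun n =>
    ⟨0, fun h => herm_ne_zero n 0 (polyToL2_injective (h.trans (map_zero _).symm))⟩
  obtain ⟨h1, h2, h3⟩ := spectral_description_of_complete_eigenvectors
    (hd.mono (onTest sqWeight sqWeight_contDiff B).le_closure.1)
    hc.closure_isClosed (isFormalAdjoint_self_closure hc hs) (lam := fun n => (n : ℝ) + c)
    (fun m n h => by simpa using h) (exists_separation_nat_add c) he hne
    span_polyToL2_herm_topologicalClosure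
  refine ⟨h1, ?_, fun n => ?_⟩
  · rw [h2]
    simp only [hcast]
  · rw [← h3 n, hcast]

lemma not_finiteDimensional_closedSpan_herm (n : ℕ) :
    ¬ FiniteDimensional ℂ (closedSpan fun b => polyToL2 (herm n b)) := by
  intro h
  have h1 : LinearIndependent ℂ fun b => herm n b :=
    LinearIndependent.of_comp polys.subtype (linearIndependent_herm n)
  have h2 : LinearIndependent ℂ fun b => polyToL2 (herm n b) :=
    h1.map' polyToL2 (LinearMap.ker_eq_bot.2 polyToL2_injective)
  have h3 : LinearIndependent ℂ fun b => (⟨polyToL2 (herm n b), mem_closedSpan _ b⟩ :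
      closedSpan fun b => polyToL2 (herm n b)) :=
    LinearIndependent.of_comp (Submodule.subtype _) h2
  have := h3.finite
  exact not_finite ℕ

lemma dbarStarLin_dbarLin_apply (f : testFunctions) (z : ℂ) :
    ((dbarStarLin sqWeight sqWeight_contDiff ∘ₗ dbarLin) f : ℂ → ℂ) z =
      lap f z + (0 : ℕ) * f.1 z := by
  rw [Nat.cast_zero, zero_mul, add_zero]
  exact dbarStar_dbar _ z

lemma dbarLin_dbarStarLin_apply (f : testFunctions) (z : ℂ) :
    ((dbarLin ∘ₗ dbarStarLin sqWeight sqWeight_contDiff) f : ℂ → ℂ) z =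
      lap f z + (1 : ℕ) * f.1 z := by
  rw [Nat.cast_one, one_mul]
  exact dbar_dbarStar f.2.1 z

lemma box0_spectral_description :
    IsSelfAdjoint (box0 sqWeight sqWeight_contDiff) ∧
    spec (box0 sqWeight sqWeight_contDiff) = {μ : ℂ | ∃ n : ℕ, μ = n} ∧
    ∀ n : ℕ, eigenspace (box0 sqWeight sqWeight_contDiff) n =
      closedSpan fun b => polyToL2 (herm n b) :=
  spectral_description_of_lap_add dbarStarLin_dbarLin_apply fun f g => by
    rw [LinearMap.comp_apply, inner_dbarStar_testToL2, inner_dbar_testToL2]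
    rfl

lemma box1_spectral_description :
    IsSelfAdjoint (box1 sqWeight sqWeight_contDiff) ∧
    spec (box1 sqWeight sqWeight_contDiff) = {μ : ℂ | ∃ n : ℕ, μ = (n + 1 : ℕ)} ∧
    ∀ n : ℕ, eigenspace (box1 sqWeight sqWeight_contDiff) ((n + 1 : ℕ) : ℂ) =
      closedSpan fun b => polyToL2 (herm n b) :=
  spectral_description_of_lap_add dbarLin_dbarStarLin_apply fun f g => by
    rw [LinearMap.comp_apply, inner_dbar_testToL2, inner_dbarStar_testToL2]
    rfl

lemma isLeast_essSpec_box0 :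
    IsLeast {t : ℝ | (t : ℂ) ∈ essSpec (box0 sqWeight sqWeight_contDiff)} 0 := by
  obtain ⟨-, h1, h2⟩ := box0_spectral_description
  constructor
  · refine ⟨?_, fun h => ?_⟩
    · rw [h1]
      exact ⟨0, by simp⟩
    -- Membership in the discrete spectrum fails through the multiplicity: the eigenspace for `0` is
    -- infinite-dimensional.
    · have h3 := h.2.2.2
      have h4 := h2 0
      rw [Nat.cast_zero] at h4
      rw [ofReal_zero, h4] at h3
      exact not_finiteDimensional_closedSpan_herm 0 h3
  · rintro t ⟨ht, -⟩
    rw [h1] at ht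
    obtain ⟨n, hn⟩ := ht
    have : t = n := by exact_mod_cast hn
    rw [this]
    positivity

/-- The row `herm n b` splits at the diagonal: `b ≤ n` gives `u_{n-b,b}`, and `b ≥ n` gives
`v_{n,b-n}`. The two families overlap at `b = n`. -/
lemma eigenfunctionSpan_herm (n : ℕ) :
    eigenfunctionSpan (fun k m => polyToL2 (herm (k + m) m))
      (fun k m => polyToL2 (herm k (k + m))) n = closedSpan fun b => polyToL2 (herm n b) := by
  rw [eigenfunctionSpan, closedSpan]
  congr 2
  ext x
  constructor
  · rintro (⟨k, m, rfl, rfl⟩ | ⟨m, rfl⟩)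
    · exact ⟨m, rfl⟩
    · exact ⟨n + m, rfl⟩
  · rintro ⟨b, rfl⟩
    rcases le_total b n with h | h
    · exact Or.inl ⟨n - b, b, by omega, by simp only [Nat.sub_add_cancel h]⟩
    · exact Or.inr ⟨b - n, by simp only [Nat.add_sub_cancel' h]⟩

end Spectrum

end DbarNeumann

open DbarNeumann
theorem theorem1 :
    -- the two differential operators are the explicit ones on `C_0^∞(ℂ)`
    (∀ f ∈ testFunctions, ∀ z : ℂ,
      dbarStar sqWeight (dbar f) z = -dz (dbar f) z + (starRingEnd ℂ) z * dbar f z ∧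
      dbar (dbarStar sqWeight f) z = -dz (dbar f) z + (starRingEnd ℂ) z * dbar f z + f z) ∧
    -- the closures are self-adjoint
    IsSelfAdjoint (box0 sqWeight sqWeight_contDiff) ∧
    IsSelfAdjoint (box1 sqWeight sqWeight_contDiff) ∧
    -- the spectrum on functions
    spec (box0 sqWeight sqWeight_contDiff) = {μ : ℂ | ∃ n : ℕ, μ = n} ∧
    (∀ n : ℕ, ¬ FiniteDimensional ℂ (eigenspace (box0 sqWeight sqWeight_contDiff) n)) ∧
    IsLeast {t : ℝ | (t : ℂ) ∈ essSpec (box0 sqWeight sqWeight_contDiff)} 0 ∧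
    -- the spectrum on `(0,1)`-forms
    spec (box1 sqWeight sqWeight_contDiff) = {μ : ℂ | ∃ n : ℕ, 1 ≤ n ∧ μ = n} ∧
    (∀ n : ℕ, 1 ≤ n →
      ¬ FiniteDimensional ℂ (eigenspace (box1 sqWeight sqWeight_contDiff) n)) ∧
    -- the eigenfunctions
    ∃ U V : ℕ → ℕ → L2 sqWeight,
      (∀ k m, U k m =ᵐ[weightMeasure sqWeight] uPoly k m) ∧
      (∀ k m, V k m =ᵐ[weightMeasure sqWeight] vPoly k m) ∧
      (∀ k m, U k m ≠ 0 ∧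
        U k m ∈ eigenspace (box0 sqWeight sqWeight_contDiff) ((k + m : ℕ) : ℂ) ∧
        U k m ∈ eigenspace (box1 sqWeight sqWeight_contDiff) ((k + m + 1 : ℕ) : ℂ)) ∧
      (∀ k m, V k m ≠ 0 ∧
        V k m ∈ eigenspace (box0 sqWeight sqWeight_contDiff) (k : ℂ) ∧
        V k m ∈ eigenspace (box1 sqWeight sqWeight_contDiff) ((k + 1 : ℕ) : ℂ)) ∧
      (∀ n : ℕ,
        eigenspace (box0 sqWeight sqWeight_contDiff) n = eigenfunctionSpan U V n ∧
        eigenspace (box1 sqWeight sqWeight_contDiff) ((n + 1 : ℕ) : ℂ) =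
          eigenfunctionSpan U V n) := by
  obtain ⟨h0a, h0s, h0e⟩ := box0_spectral_description
  obtain ⟨h1a, h1s, h1e⟩ := box1_spectral_description
  have hmem : ∀ n b, polyToL2 (herm n b) ∈ closedSpan fun b => polyToL2 (herm n b) := fun n b =>
    mem_closedSpan _ b
  have hne : ∀ n b, polyToL2 (herm n b) ≠ 0 := fun n b h =>
    herm_ne_zero n b (polyToL2_injective (h.trans (map_zero _).symm))
  refine ⟨fun f hf z => ⟨dbarStar_dbar f z, dbar_dbarStar hf.1 z⟩, h0a, h1a, h0s, fun n => ?_,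
    isLeast_essSpec_box0, ?_, fun n hn => ?_, fun k m => polyToL2 (herm (k + m) m),
    fun k m => polyToL2 (herm k (k + m)), fun k m => ?_, fun k m => ?_,
    fun k m => ⟨hne _ _, ?_, ?_⟩, fun k m => ⟨hne _ _, ?_, ?_⟩, fun n => ⟨?_, ?_⟩⟩
  · rw [h0e]
    exact not_finiteDimensional_closedSpan_herm n
  · rw [h1s]
    ext μ
    constructor
    · rintro ⟨n, rfl⟩
      exact ⟨n + 1, by omega, rfl⟩
    · rintro ⟨n, hn, rfl⟩
      exact ⟨n - 1, by rw [Nat.sub_add_cancel hn]⟩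
  · obtain ⟨m, rfl⟩ := Nat.exists_eq_add_of_le' hn
    rw [h1e]
    exact not_finiteDimensional_closedSpan_herm m
  · rw [uPoly_eq_herm]
    exact (memLp_of_mem_polys (herm (k + m) m).2).coeFn_toLp
  · rw [vPoly_eq_herm]
    exact (memLp_of_mem_polys (herm k (k + m)).2).coeFn_toLp
  · rw [h0e]
    exact hmem _ _
  · rw [h1e]
    exact hmem _ _
  · rw [h0e]
    exact hmem _ _
  · rw [h1e]
    exact hmem _ _
  · rw [h0e, eigenfunctionSpan_herm]
  · rw [h1e, eigenfunctionSpan_herm]
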